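/- Let $(M,g)$ be a smooth Riemannian manifold of dimension $n\ge 3$, with Levi-Civita connection $\nabla$, curvature $R(X,Y)Z=\nabla_X\nabla_YZ-\nabla_Y\nabla_XZ-\nabla_{[X,Y]}Z$, Ricci tensor $\mathrm{Ric}(Y,Z)=\operatorname{trace}(X\mapsto R(X,Y)Z)$, Ricci operator $Q$ given by $g(QX,Y)=\mathrm{Ric}(X,Y)$, and scalar curvature $\mathrm{scal}=\operatorname{trace}Q$. Let $f$ and $\lambda$ be smooth real functions on $M$ such that $(V=\operatorname{grad}f,\lambda)$ defines a gradient almost Einstein soliton, i.e. $$\tfrac12\,\mathcal L_{V}g+\mathrm{Ric}=\Big(\frac{\mathrm{scal}}{2}+\lambda\Big)g ,\qquad V=\operatorname{grad}f,$$ where $\mathcal L_V g$ is the Lie derivative of $g$ along $V$ (the field $V$ is allowed to have zeros). Then on $M$ $$Q(\operatorname{grad}f)=-(n-1)\operatorname{grad}\lambda-\frac{n-2}{2}\operatorname{grad}(\mathrm{scal}).$$ Moreover, if $\operatorname{grad}f\in\ker Q$, i.e. $Q(\operatorname{grad}f)=0$ on $M$, then $$\operatorname{grad}\lambda=\operatorname{grad}(\Delta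 f)=-\frac{n-2}{2(n-1)}\operatorname{grad}(\mathrm{scal}),$$ where $\Delta f=\operatorname{div}(\operatorname{grad}f)$ and $\operatorname{div}X=\operatorname{trace}(Y\mapsto\nabla_YX)$. -/

import Mathlib

open Bundle FiberBundle VectorField
open scoped Manifold ContDiff

set_option linter.unusedSectionVars false

noncomputable section

namespace RiemGeom

variable {E : Type*} [NormedAddCommGroup E] [NormedSpace ℝ E] [FiniteDimensional ℝ E]
  {H : Type*} [TopologicalSpace H] (I : ModelWithCorners ℝ E H)
  {M : Type*} [TopologicalSpace M] [ChartedSpace H M] [IsManifold I ∞ M]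
  [RiemannianBundle (fun x : M ↦ TangentSpace I x)]

/-! ### The Levi-Civita connection -/

/-- The function `g(X, Y)` for two vector fields `X`, `Y`. -/
def metric (X Y : Π x : M, TangentSpace I x) (x : M) : ℝ := inner ℝ (X x) (Y x)

/-- The right-hand side of Koszul's formula,
`½ (X g(Y,Z) + Y g(X,Z) - Z g(X,Y) + g([X,Y],Z) - g([X,Z],Y) - g([Y,Z],X))`. -/
def koszul (X Y Z : Π x : M, TangentSpace I x) (x : M) : ℝ :=
  (1 / 2 : ℝ) * (mvfderiv I (metric I Y Z) x (X x) + mvfderiv I (metric I X Z) x (Y x)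
    - mvfderiv I (metric I X Y) x (Z x)
    + metric I (mlieBracket I X Y) Z x - metric I (mlieBracket I X Z) Y x
    - metric I (mlieBracket I Y Z) X x)

instance tangentFiniteDimensional (x : M) : FiniteDimensional ℝ (TangentSpace I x) :=
  inferInstanceAs (FiniteDimensional ℝ E)

instance tangentComplete (x : M) : CompleteSpace (TangentSpace I x) :=
  FiniteDimensional.complete ℝ _

variable [IsContMDiffRiemannianBundle I ∞ E (fun x : M ↦ TangentSpace I x)]
variable {I}

theorem metric_mdiff {X Y : Π x : M, TangentSpace I x} {x : M}
    (hX : MDiffAt (T% X) x) (hY : MDiffAt (T% Y) x) : MDiffAt (metric I X Y) x :=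
  MDifferentiableAt.inner_bundle (b := id) hX hY


theorem koszul_tensorial_left {Y Z : Π x : M, TangentSpace I x} {x : M}
    (hY : MDiffAt (T% Y) x) (hZ : MDiffAt (T% Z) x) :
    TensorialAt I E (koszul I · Y Z x) x where
  smul {f X} hf hX := by
    have e1 : metric I (f • X) Z = f * metric I X Z := by
      ext y; simp [metric, inner_smul_left]
    have e2 : metric I (f • X) Y = f * metric I X Y := by
      ext y; simp [metric, inner_smul_left]
    simp only [koszul, e1, e2]
    rw [mvfderiv_mul hf (metric_mdiff hX hZ), mvfderiv_mul hf (metric_mdiff hX hY)]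
    simp [metric, mlieBracket_smul_left hf hX, inner_add_left, inner_smul_left, inner_smul_right]
    ring
  add {X X'} hX hX' := by
    have e1 (W : Π x : M, TangentSpace I x) :
        metric I (X + X') W = metric I X W + metric I X' W := by
      ext y; simp [metric, inner_add_left]
    simp only [koszul, e1]
    rw [mvfderiv_add (metric_mdiff hX hZ) (metric_mdiff hX' hZ),
      mvfderiv_add (metric_mdiff hX hY) (metric_mdiff hX' hY)]
    simp [metric, mlieBracket_add_left hX hX', inner_add_left, inner_add_right]
    ring

theorem koszul_tensorial_right {X Y : Π x : M, TangentSpace I x} {x : M}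
    (hX : MDiffAt (T% X) x) (hY : MDiffAt (T% Y) x) :
    TensorialAt I E (koszul I X Y · x) x where
  smul {f Z} hf hZ := by
    have e1 (W : Π x : M, TangentSpace I x) : metric I W (f • Z) = f * metric I W Z := by
      ext y; simp [metric, inner_smul_right]
    simp only [koszul, e1]
    rw [mvfderiv_mul hf (metric_mdiff hX hZ), mvfderiv_mul hf (metric_mdiff hY hZ)]
    simp [metric, mlieBracket_smul_right hf hZ, inner_add_left, inner_smul_left,
      real_inner_comm]
    ring
  add {Z Z'} hZ hZ' := by
    have e1 (W : Π x : M, TangentSpace I x) :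
        metric I W (Z + Z') = metric I W Z + metric I W Z' := by
      ext y; simp [metric, inner_add_right]
    simp only [koszul, e1]
    rw [mvfderiv_add (metric_mdiff hX hZ) (metric_mdiff hX hZ'),
      mvfderiv_add (metric_mdiff hY hZ) (metric_mdiff hY hZ')]
    simp [metric, mlieBracket_add_right hZ hZ', inner_add_left]
    ring

/-- For `Y` differentiable at `x`, the bilinear form `(u, w) ↦ g(∇_u Y, w)` on the tangent space
at `x`, obtained from Koszul's formula. -/
def koszulForm (Y : Π x : M, TangentSpace I x) (x : M) (hY : MDiffAt (T% Y) x) :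
    TangentSpace I x →L[ℝ] TangentSpace I x →L[ℝ] ℝ :=
  TensorialAt.mkHom₂ (I := I) (F := E) (F' := E) (koszul I · Y · x) x
    (fun _ hZ ↦ koszul_tensorial_left hY hZ) (fun _ hX ↦ koszul_tensorial_right hX hY)

open Classical in
/-- The Levi-Civita derivative of a vector field `Y` at `x`, as the linear map `u ↦ ∇_u Y`: it is
the endomorphism of the tangent space with `g(∇_u Y, w) = koszulForm Y x u w` (and `0` by
convention if `Y` is not differentiable at `x`). -/
def leviCivitaFun (Y : Π x : M, TangentSpace I x) (x : M) :
    TangentSpace I x →L[ℝ] TangentSpace I x :=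
  if hY : MDiffAt (T% Y) x then
    LinearMap.toContinuousLinearMap
      { toFun := fun u ↦ (InnerProductSpace.toDual ℝ (TangentSpace I x)).symm (koszulForm Y x hY u)
        map_add' := fun u v ↦ by simp
        map_smul' := fun c u ↦ by simp }
  else 0

theorem inner_leviCivitaFun {X Y Z : Π x : M, TangentSpace I x} {x : M}
    (hX : MDiffAt (T% X) x) (hY : MDiffAt (T% Y) x) (hZ : MDiffAt (T% Z) x) :
    inner ℝ (leviCivitaFun Y x (X x)) (Z x) = koszul I X Y Z x := by
  rw [leviCivitaFun, dif_pos hY]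
  simp only [LinearMap.coe_toContinuousLinearMap', LinearMap.coe_mk, AddHom.coe_mk,
    InnerProductSpace.toDual_symm_apply]
  exact TensorialAt.mkHom₂_apply _ _ hX hZ

theorem eq_of_koszul {x : M} {A B : TangentSpace I x →L[ℝ] TangentSpace I x}
    (h : ∀ X Z : Π x : M, TangentSpace I x, MDiffAt (T% X) x → MDiffAt (T% Z) x →
      inner ℝ (A (X x)) (Z x) = inner ℝ (B (X x)) (Z x)) : A = B := by
  ext u
  refine ext_inner_right ℝ fun w ↦ ?_
  simpa using h (extend E u) (extend E w) (mdifferentiableAt_extend ..)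
    (mdifferentiableAt_extend ..)

variable (I M) in
/-- The Levi-Civita connection; `leviCivita I M Y x u` is `∇_u Y` for a tangent vector `u`
at `x`. -/
def leviCivita : CovariantDerivative I E (fun x : M ↦ TangentSpace I x) where
  toFun := leviCivitaFun
  isCovariantDerivativeOnUniv :=
    { add := fun {Y Y' x} hY hY' _ ↦ by
        refine eq_of_koszul fun X Z hX hZ ↦ ?_
        rw [inner_leviCivitaFun hX (mdifferentiableAt_add_section hY hY') hZ,
          _root_.add_apply, inner_add_left, inner_leviCivitaFun hX hY hZ,
          inner_leviCivitaFun hX hY' hZ]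
        have e1 (W : Π x : M, TangentSpace I x) :
            metric I (Y + Y') W = metric I Y W + metric I Y' W := by
          ext y; simp [metric, inner_add_left]
        have e2 (W : Π x : M, TangentSpace I x) :
            metric I W (Y + Y') = metric I W Y + metric I W Y' := by
          ext y; simp [metric, inner_add_right]
        simp only [koszul, e1, e2]
        rw [mvfderiv_add (metric_mdiff hY hZ) (metric_mdiff hY' hZ),
          mvfderiv_add (metric_mdiff hX hY) (metric_mdiff hX hY')]
        simp [metric, mlieBracket_add_left hY hY', mlieBracket_add_right hY hY', inner_add_left]
        ring
      leibniz := fun {Y f x} hY hf _ ↦ by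
        refine eq_of_koszul fun X Z hX hZ ↦ ?_
        rw [inner_leviCivitaFun hX (hf.smul_section hY) hZ,
          _root_.add_apply, inner_add_left, _root_.smul_apply,
          inner_smul_left, inner_leviCivitaFun hX hY hZ]
        have e1 (W : Π x : M, TangentSpace I x) : metric I (f • Y) W = f * metric I Y W := by
          ext y; simp [metric, inner_smul_left]
        have e2 (W : Π x : M, TangentSpace I x) : metric I W (f • Y) = f * metric I W Y := by
          ext y; simp [metric, inner_smul_right]
        simp only [koszul, e1, e2]
        rw [mvfderiv_mul hf (metric_mdiff hY hZ), mvfderiv_mul hf (metric_mdiff hX hY)]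
        simp [metric, mlieBracket_smul_left hf hY, mlieBracket_smul_right hf hY, inner_add_left,
          inner_smul_left, real_inner_comm]
        ring }

/-- The Levi-Civita connection is compatible with the metric:
`X (g(Y, Z)) = g(∇_X Y, Z) + g(Y, ∇_X Z)`. -/
theorem leviCivita_metric {X Y Z : Π x : M, TangentSpace I x} {x : M}
    (hX : MDiffAt (T% X) x) (hY : MDiffAt (T% Y) x) (hZ : MDiffAt (T% Z) x) :
    mvfderiv I (metric I Y Z) x (X x) = inner ℝ (leviCivita I M Y x (X x)) (Z x)
      + inner ℝ (Y x) (leviCivita I M Z x (X x)) := by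
  have h1 := inner_leviCivitaFun hX hY hZ
  have h2 := inner_leviCivitaFun hX hZ hY
  have e : metric I Z Y = metric I Y Z := by ext y; simp [metric, real_inner_comm]
  have e' : mlieBracket I Z Y = - mlieBracket I Y Z := mlieBracket_swap
  change _ = inner ℝ (leviCivitaFun Y x (X x)) (Z x)
    + inner ℝ (Y x) (leviCivitaFun Z x (X x))
  rw [h1, real_inner_comm, h2]
  simp only [koszul, e, e', metric, Pi.neg_apply, inner_neg_left]
  ring

/-- The Levi-Civita connection is torsion-free. -/
theorem leviCivita_torsion : (leviCivita I M).torsion = 0 := by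
  rw [CovariantDerivative.torsion_eq_zero_iff]
  intro X Y x hX hY
  refine ext_inner_right ℝ fun w ↦ ?_
  have hZ : MDiffAt (T% (extend E w : Π x : M, TangentSpace I x)) x := mdifferentiableAt_extend ..
  have h1 := inner_leviCivitaFun hX hY hZ
  have h2 := inner_leviCivitaFun hY hX hZ
  have e : metric I Y X = metric I X Y := by ext y; simp [metric, real_inner_comm]
  have e' : mlieBracket I Y X = - mlieBracket I X Y := mlieBracket_swap
  rw [extend_apply_self] at h1 h2
  change inner ℝ (leviCivitaFun Y x (X x) - leviCivitaFun X x (Y x)) w = _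
  rw [inner_sub_left, h1, h2]
  simp only [koszul, e, e', metric, Pi.neg_apply, inner_neg_left, extend_apply_self]
  ring

/-! ### Curvature -/

variable (I M) in
/-- The vector field `R(X, Y)Z = ∇_X ∇_Y Z - ∇_Y ∇_X Z - ∇_[X,Y] Z`. -/
def curvature (X Y Z : Π x : M, TangentSpace I x) (x : M) : TangentSpace I x :=
  leviCivita I M (fun y ↦ leviCivita I M Z y (Y y)) x (X x)
    - leviCivita I M (fun y ↦ leviCivita I M Z y (X y)) x (Y x)
    - leviCivita I M Z x (mlieBracket I X Y x)

/-- The Riemann curvature tensor at `x`: `R(u, v)w` is computed by extending `u`, `v`, `w` to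
vector fields that are smooth near `x` (by tensoriality the choice of extension is immaterial). -/
def riemann (x : M) (u v w : TangentSpace I x) : TangentSpace I x :=
  curvature I M (extend E u) (extend E v) (extend E w) x

/-- The Ricci tensor `Ric(v, w) = trace (u ↦ R(u, v)w)`, the trace being computed in an orthonormal
basis of the tangent space at `x`. -/
def ricci (x : M) (v w : TangentSpace I x) : ℝ :=
  ∑ i, inner ℝ (riemann x (stdOrthonormalBasis ℝ (TangentSpace I x) i) v w)
    (stdOrthonormalBasis ℝ (TangentSpace I x) i)

/-- The Ricci operator `Q`, i.e. `g(Q v, w) = Ric(v, w)`: the vector `Q v` with components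
`Ric(v, e i)` in an orthonormal basis `e` of the tangent space at `x`. -/
def ricciOperator (x : M) (v : TangentSpace I x) : TangentSpace I x :=
  ∑ i, ricci x v (stdOrthonormalBasis ℝ (TangentSpace I x) i) •
    stdOrthonormalBasis ℝ (TangentSpace I x) i

variable (I) in
/-- The scalar curvature, the trace of the Ricci tensor with respect to the metric. -/
def scal (x : M) : ℝ :=
  ∑ i, ricci x (stdOrthonormalBasis ℝ (TangentSpace I x) i)
    (stdOrthonormalBasis ℝ (TangentSpace I x) i)

/-! ### Gradient, divergence, Laplacian, Lie derivative of the metric -/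

variable (I) in
/-- The gradient of `f`: `g(grad f, v) = df(v)`. -/
def grad (f : M → ℝ) (x : M) : TangentSpace I x :=
  (InnerProductSpace.toDual ℝ (TangentSpace I x)).symm (mvfderiv I f x)

/-- The divergence of a vector field, the trace of `u ↦ ∇_u V`. -/
def divergence (V : Π x : M, TangentSpace I x) (x : M) : ℝ :=
  LinearMap.trace ℝ (TangentSpace I x) (leviCivita I M V x)

variable (I) in
/-- The Laplacian `Δ f = div (grad f)`. -/
def laplacian (f : M → ℝ) : M → ℝ := divergence (grad I f)

/-- The Lie derivative of the metric,
`(L_V g)(X, Y) = V (g(X, Y)) - g([V, X], Y) - g(X, [V, Y])`, on tangent vectors `u`, `v` at `x`,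
which are extended to vector fields that are smooth near `x` (the choice of extension is
immaterial). -/
def lieMetric (V : Π x : M, TangentSpace I x) (x : M) (u v : TangentSpace I x) : ℝ :=
  mvfderiv I (metric I (extend E u) (extend E v)) x (V x)
    - inner ℝ (mlieBracket I V (extend E u) x) v
    - inner ℝ u (mlieBracket I V (extend E v) x)

/-! ### Almost Einstein solitons -/

/-- A smooth vector field `V` and a smooth function `lam` define an almost Einstein soliton if
`½ L_V g + Ric = (scal / 2 + lam) g`. Here `V` may have zeros. -/
structure IsAlmostEinsteinSoliton (V : Π x : M, TangentSpace I x) (lam : M → ℝ) : Prop where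
  smooth_field : ContMDiff I I.tangent ∞ (fun x ↦ (⟨x, V x⟩ : TangentBundle I M))
  smooth_function : ContMDiff I 𝓘(ℝ, ℝ) ∞ lam
  equation : ∀ (x : M) (u v : TangentSpace I x),
    (1 / 2 : ℝ) * lieMetric V x u v + ricci x u v = (scal I x / 2 + lam x) * inner ℝ u v

end RiemGeom

end

/-!
The proof computes with smooth vector fields on all of `M`. At a point `x`, take a normal frame:
fields `e_k` that are orthonormal at `x` and have `∇ e_k = 0` there. They need not be orthonormal or
even commute elsewhere, because the derivative of a trace is the trace of the covariant derivative
(`dirDeriv_trace`), which may be evaluated in such a family.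

Since `grad f` has symmetric Hessian (`inner_leviCivita_grad_comm`), the soliton equation reads
`∇_u grad f = φ u - Q u` with `φ = scal / 2 + λ`; in particular `Ric` is symmetric. Inserting this
in the definition of the curvature gives, for `V = grad f`,
`R(X, Y)V = (Xφ) Y - (Yφ) X - (∇_X Q)Y + (∇_Y Q)X`,
whose trace over `X` is `Ric(Y, V) = (1 - n) Yφ - (div Q)(Y) + Y scal`. By the contracted second
Bianchi identity, `div Q = ½ d scal` (`NormalFrame.contracted_bianchi`), this becomes
`Ric(Y, V) = (1 - n) Yφ + ½ Y scal` (`NormalFrame.ricci_apply`), the formula for `Q (grad f)`.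
In a normal frame, the second Bianchi identity is the Jacobi identity for the operators `∇_X`, and
contracting it twice only uses the antisymmetry of the curvature in each pair of arguments.

The trace of the soliton equation is `Δf = n λ + ((n - 2) / 2) scal`. If `Q (grad f) = 0`, the
formula for `Q (grad f)` expresses `grad λ` through `grad scal`, and `grad Δf` is then equal to it.

Two facts support the calculus. A map on smooth fields that is linear over smooth functions is given
by a linear map on the tangent space (`exists_linearMap_of_tensorial`), which makes the curvature
independent of the extensions used to define it. A field is smooth if its inner products with
smooth fields are (`smoothField_of_metric`), so that `∇_X Y`, `grad f` and `Q X` are smooth.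
-/

noncomputable section

namespace RiemGeom

variable {E : Type*} [NormedAddCommGroup E] [NormedSpace ℝ E] [FiniteDimensional ℝ E]
  {H : Type*} [TopologicalSpace H] {I : ModelWithCorners ℝ E H}
  {M : Type*} [TopologicalSpace M] [ChartedSpace H M] [IsManifold I ∞ M]

/-! ### Smooth vector fields -/

variable (I) in
/-- The vector field `X` is smooth on all of `M`. -/
def SmoothField (X : Π x : M, TangentSpace I x) : Prop :=
  ContMDiff I I.tangent ∞ (fun x ↦ (⟨x, X x⟩ : TangentBundle I M))

variable (I) in
/-- The function `X f`, the derivative of `f` along the vector field `X`. -/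
def dirDeriv (X : Π x : M, TangentSpace I x) (f : M → ℝ) (x : M) : ℝ := mvfderiv I f x (X x)

section Smooth

variable {X Y : Π x : M, TangentSpace I x} {f : M → ℝ}

theorem SmoothField.mdiff (hX : SmoothField I X) (x : M) : MDiffAt (T% X) x :=
  (hX x).mdifferentiableAt (by simp)

theorem SmoothField.add (hX : SmoothField I X) (hY : SmoothField I Y) : SmoothField I (X + Y) :=
  ContMDiff.add_section hX hY

theorem SmoothField.sub (hX : SmoothField I X) (hY : SmoothField I Y) : SmoothField I (X - Y) :=
  ContMDiff.sub_section hX hY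

theorem SmoothField.smul (hf : ContMDiff I 𝓘(ℝ, ℝ) ∞ f) (hX : SmoothField I X) :
    SmoothField I (f • X) :=
  ContMDiff.smul_section hf hX

theorem SmoothField.sum {ι : Type*} {s : Finset ι} {X : ι → Π x : M, TangentSpace I x}
    (hX : ∀ i, SmoothField I (X i)) : SmoothField I (fun x ↦ ∑ i ∈ s, X i x) :=
  ContMDiff.sum_section (fun i _ ↦ hX i)

theorem SmoothField.mlieBracket (hX : SmoothField I X) (hY : SmoothField I Y) :
    SmoothField I (mlieBracket I X Y) := by
  have h3 : IsManifold I (minSmoothness ℝ 3) M := by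
    rw [minSmoothness_of_isRCLikeNormedField]; infer_instance
  have : IsManifold I (((⊤ : ℕ∞) : ℕ∞ω) + 1) M := ‹IsManifold I ∞ M›
  exact ContDiff.mlieBracket_vectorField (n := ⊤) (m := ⊤) hX hY (by simp)

theorem SmoothField.dirDeriv (hX : SmoothField I X) (hf : ContMDiff I 𝓘(ℝ, ℝ) ∞ f) :
    ContMDiff I 𝓘(ℝ, ℝ) ∞ (dirDeriv I X f) := by
  have h1 : ContMDiff I.tangent 𝓘(ℝ, ℝ).tangent ∞ (tangentMap I 𝓘(ℝ, ℝ) f) :=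
    hf.contMDiff_tangentMap (by simp)
  exact (contMDiff_snd_tangentBundle_modelSpace ℝ 𝓘(ℝ, ℝ)).comp (h1.comp hX)

/-- Cut off by a bump function, a vector field that is smooth near `x` becomes smooth on all of `M`
without changing its germ at `x`. -/
theorem exists_smoothField_eventuallyEq [T2Space M] {x : M} {U : Set M} (hU : U ∈ nhds x)
    (hX : ContMDiffOn I I.tangent ∞ (fun x ↦ (⟨x, X x⟩ : TangentBundle I M)) U) :
    ∃ X' : Π x : M, TangentSpace I x, SmoothField I X' ∧ ∀ᶠ y in nhds x, X' y = X y := by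
  obtain ⟨V, hVU, hV, hxV⟩ := mem_nhds_iff.1 hU
  obtain ⟨ψ, -, hψ⟩ := (SmoothBumpFunction.nhds_basis_tsupport (I := I) x).mem_iff.1
    (hV.mem_nhds hxV)
  refine ⟨(ψ : M → ℝ) • X, ?_, ?_⟩
  · exact ContMDiffOn.smul_section_of_tsupport ψ.contMDiff.contMDiffOn hV hψ (hX.mono hVU)
  · filter_upwards [ψ.eventuallyEq_one] with y hy
    simp [hy]

theorem exists_smoothField_extend [T2Space M] {x : M} (v : TangentSpace I x) :
    ∃ X : Π x : M, TangentSpace I x, SmoothField I X ∧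
      ∀ᶠ y in nhds x, X y = (extend E v : Π x : M, TangentSpace I x) y := by
  obtain ⟨s, hs, h⟩ := exists_contMDiffOn_extend (k := ∞) I E v
  exact exists_smoothField_eventuallyEq hs h

theorem exists_smoothField_apply_eq [T2Space M] {x : M} (v : TangentSpace I x) :
    ∃ X : Π x : M, TangentSpace I x, SmoothField I X ∧ X x = v := by
  obtain ⟨X, hX, h⟩ := exists_smoothField_extend v
  exact ⟨X, hX, by simpa using h.self_of_nhds⟩

/-- On functions the Lie bracket acts as the commutator of derivations. This is read off from the
Jacobi identity `[X, [Y, fZ]] = [[X, Y], fZ] + [Y, [X, fZ]]` by expanding it with the Leibniz rule: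
all terms cancel except `(XYf - YXf - [X, Y]f) Z`. -/
theorem dirDeriv_mlieBracket [T2Space M] (hX : SmoothField I X) (hY : SmoothField I Y)
    (hf : ContMDiff I 𝓘(ℝ, ℝ) ∞ f) :
    dirDeriv I (mlieBracket I X Y) f
      = dirDeriv I X (dirDeriv I Y f) - dirDeriv I Y (dirDeriv I X f) := by
  ext x
  by_cases h : Subsingleton (TangentSpace I x)
  · simp [dirDeriv, Subsingleton.elim (X x) 0, Subsingleton.elim (Y x) 0,
      Subsingleton.elim (VectorField.mlieBracket I X Y x) 0]
  rw [not_subsingleton_iff_nontrivial] at h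
  obtain ⟨v, hv⟩ := exists_ne (0 : TangentSpace I x)
  obtain ⟨Z, hZ, rfl⟩ := exists_smoothField_apply_eq v
  have h3 : IsManifold I (minSmoothness ℝ 3) M := by
    rw [minSmoothness_of_isRCLikeNormedField]; infer_instance
  have leib {W : Π x : M, TangentSpace I x} {g : M → ℝ} (V : Π x : M, TangentSpace I x)
      (hW : SmoothField I W) (hg : ContMDiff I 𝓘(ℝ, ℝ) ∞ g) :
      VectorField.mlieBracket I V (g • W)
        = dirDeriv I V g • W + g • VectorField.mlieBracket I V W := by
    ext y
    exact mlieBracket_smul_right ((hg y).mdifferentiableAt (by simp)) (hW.mdiff y)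
  have h2 : minSmoothness ℝ 2 ≤ ∞ := by
    rw [minSmoothness_of_isRCLikeNormedField]
    exact ENat.LEInfty.out
  have jac {W : Π x : M, TangentSpace I x} (hW : SmoothField I W) :=
    leibniz_identity_mlieBracket_apply (𝕜 := ℝ) (x := x)
      ((hX x).of_le h2)
      ((hY x).of_le h2)
      ((hW x).of_le h2)
  have e := jac (hZ.smul hf)
  have e0 := jac hZ
  have hXf := hX.dirDeriv hf
  have hYf := hY.dirDeriv hf
  rw [leib _ hZ hf, leib _ hZ hf, leib _ hZ hf] at e
  rw [mlieBracket_add_right ((hZ.smul hYf).mdiff x) (((hY.mlieBracket hZ).smul hf).mdiff x),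
    mlieBracket_add_right ((hZ.smul hXf).mdiff x) (((hX.mlieBracket hZ).smul hf).mdiff x),
    leib _ hZ hXf, leib _ hZ hYf, leib _ (hY.mlieBracket hZ) hf,
    leib _ (hX.mlieBracket hZ) hf] at e
  simp only [Pi.add_apply, Pi.smul_apply', e0] at e
  have key : (dirDeriv I (VectorField.mlieBracket I X Y) f x
      - (dirDeriv I X (dirDeriv I Y f) x - dirDeriv I Y (dirDeriv I X f) x)) • Z x = 0 := by
    refine Eq.trans ?_ (sub_eq_zero.2 e.symm)
    module
  simpa [hv, sub_eq_zero] using key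

end Smooth

/-! ### Frames and tensoriality -/

variable (I) in
/-- A frame of the tangent bundle near `x`, with its dual coframe, both multiplied by the same
bump function so that they are defined and smooth on all of `M`. The expansion of a vector in the
frame holds on all of `M` up to the factor `cutoff`, the square of that bump function. -/
structure CutoffFrame (x : M) where
  /-- The factor in the expansion of a vector in the frame. -/
  cutoff : M → ℝ
  /-- The vector fields of the frame. -/
  field : Fin (Module.finrank ℝ E) → Π y : M, TangentSpace I y
  /-- The dual coframe. -/
  coeff : Fin (Module.finrank ℝ E) → Π y : M, TangentSpace I y →ₗ[ℝ] ℝ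
  contMDiff_cutoff : ContMDiff I 𝓘(ℝ, ℝ) ∞ cutoff
  eventually_cutoff : ∀ᶠ y in nhds x, cutoff y = 1
  smooth_field : ∀ i, SmoothField I (field i)
  contMDiff_coeff : ∀ i X, SmoothField I X → ContMDiff I 𝓘(ℝ, ℝ) ∞ (fun y ↦ coeff i y (X y))
  expand : ∀ y v, cutoff y • v = ∑ i, coeff i y v • field i y
  dual : ∀ᶠ y in nhds x, ∀ i j, coeff i y (field j y) = if i = j then 1 else 0

theorem nonempty_cutoffFrame [T2Space M] (x : M) : Nonempty (CutoffFrame I x) := by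
  let t := trivializationAt E (fun y : M ↦ TangentSpace I y) x
  have hx : x ∈ t.baseSet := FiberBundle.mem_baseSet_trivializationAt' x
  let b := Module.finBasis ℝ E
  obtain ⟨ψ, -, hψ⟩ := (SmoothBumpFunction.nhds_basis_tsupport (I := I) x).mem_iff.1
    (t.open_baseSet.mem_nhds hx)
  have hψ0 {y : M} (hy : y ∉ t.baseSet) : ψ y = 0 := by
    by_contra h
    exact hy (hψ (subset_tsupport _ h))
  refine ⟨⟨fun y ↦ ψ y * ψ y, fun i ↦ (ψ : M → ℝ) • t.localFrame b i,
    fun i y ↦ ψ y • t.localFrameCoeff I b i y, ψ.contMDiff.mul ψ.contMDiff, ?_, fun i ↦ ?_,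
    fun i X hX ↦ ?_, fun y v ↦ ?_, ?_⟩⟩
  · filter_upwards [ψ.eventuallyEq_one] with y hy
    simp [hy]
  · exact ContMDiffOn.smul_section_of_tsupport ψ.contMDiff.contMDiffOn t.open_baseSet hψ
      (t.contMDiffOn_localFrame_baseSet ∞ b i)
  · refine contMDiff_of_tsupport fun y hy ↦ ?_
    have hy' : y ∈ t.baseSet := hψ (closure_mono (fun z hz ↦ by
      simp only [LinearMap.smul_apply, Function.mem_support, smul_eq_mul] at hz ⊢
      exact left_ne_zero_of_mul hz) hy)
    exact ψ.contMDiffAt.mul (contMDiffAt_localFrameCoeff b hy' (hX y) i)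
  · by_cases hy : y ∈ t.baseSet
    · obtain ⟨X, hX⟩ : ∃ X : Π y : M, TangentSpace I y, X y = v := ⟨extend E v, by simp⟩
      have := (t.isLocalFrameOn_localFrame_baseSet I 1 b).coeff_sum_eq X hy
      rw [hX] at this
      conv_lhs => rw [this]
      rw [Finset.smul_sum]
      refine Finset.sum_congr rfl fun i _ ↦ ?_
      simp only [LinearMap.smul_apply, Pi.smul_apply', smul_smul, smul_eq_mul]
      congr 1
      rw [Bundle.Trivialization.localFrameCoeff]
      ring
    · simp [hψ0 hy]
  · filter_upwards [ψ.eventuallyEq_one, t.open_baseSet.mem_nhds hx] with y hy hyt i j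
    have h := (t.isLocalFrameOn_localFrame_baseSet I 1 b).coeff_apply_of_mem hyt
      (t.localFrame b j) i
    have h' := (t.isLocalFrameOn_localFrame_baseSet I 1 b).toBasisAt_coe hyt j
    rw [← h', Module.Basis.repr_self, h', Finsupp.single_apply] at h
    simp only [hy, Pi.one_apply, one_smul, Pi.smul_apply', Bundle.Trivialization.localFrameCoeff, h]
    simp [eq_comm]

/-- A map on smooth vector fields that is linear over smooth functions at `x` is given by a linear
map on the tangent space at `x`: expand the field in a frame. -/
theorem exists_linearMap_of_tensorial [T2Space M] {A : Type*} [AddCommGroup A] [Module ℝ A] {x : M}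
    {Φ : (Π y : M, TangentSpace I y) → A}
    (hadd : ∀ X Y, SmoothField I X → SmoothField I Y → Φ (X + Y) = Φ X + Φ Y)
    (hsmul : ∀ (f : M → ℝ) X, ContMDiff I 𝓘(ℝ, ℝ) ∞ f → SmoothField I X →
      Φ (f • X) = f x • Φ X) :
    ∃ L : TangentSpace I x →ₗ[ℝ] A, ∀ X, SmoothField I X → Φ X = L (X x) := by
  obtain ⟨F⟩ := nonempty_cutoffFrame (I := I) x
  refine ⟨∑ i, (F.coeff i x).smulRight (Φ (F.field i)), fun X hX ↦ ?_⟩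
  have h0 : Φ 0 = 0 := by
    have := hadd 0 0 (contMDiff_zeroSection _ _) (contMDiff_zeroSection _ _)
    simpa using this
  have hsum (s : Finset (Fin (Module.finrank ℝ E))) :
      Φ (fun y ↦ ∑ i ∈ s, F.coeff i y (X y) • F.field i y)
        = ∑ i ∈ s, F.coeff i x (X x) • Φ (F.field i) := by
    induction s using Finset.cons_induction with
    | empty =>
      simp only [Finset.sum_empty]
      exact h0
    | cons i s hi ih =>
      simp only [Finset.sum_cons, ← ih]
      rw [← hsmul _ _ (F.contMDiff_coeff i X hX) (F.smooth_field i)]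
      exact hadd _ _ ((F.smooth_field i).smul (F.contMDiff_coeff i X hX))
        (.sum fun j ↦ (F.smooth_field j).smul (F.contMDiff_coeff j X hX))
  have h := hsmul F.cutoff X F.contMDiff_cutoff hX
  rw [F.eventually_cutoff.self_of_nhds, one_smul] at h
  rw [← h, funext fun y ↦ show (F.cutoff • X) y = _ from F.expand y (X y), hsum]
  simp

/-- A covector at `x` is the differential of a function vanishing at `x`: a linear function of the
coordinates in a chart, cut off by a bump function. -/
theorem exists_contMDiff_mvfderiv_eq [T2Space M] {x : M} (l : TangentSpace I x →L[ℝ] ℝ) :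
    ∃ f : M → ℝ, ContMDiff I 𝓘(ℝ, ℝ) ∞ f ∧ f x = 0 ∧ mvfderiv I f x = l := by
  obtain ⟨A, hA⟩ := isInvertible_mfderiv_extChartAt (mem_extChartAt_source (I := I) x)
  let l' : E →L[ℝ] ℝ := l.comp A.symm.toContinuousLinearMap
  let g : M → ℝ := fun y ↦ l' (extChartAt I x y - extChartAt I x x)
  let ψ : SmoothBumpFunction I x := Classical.arbitrary _
  have hg : ContMDiffOn I 𝓘(ℝ, ℝ) ∞ g (chartAt H x).source :=
    l'.contMDiff.comp_contMDiffOn ((contMDiffOn_extChartAt).sub contMDiffOn_const)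
  refine ⟨fun y ↦ ψ y • g y, ψ.contMDiff_smul hg, by simp [g], ?_⟩
  have h1 : (fun y ↦ ψ y • g y) =ᶠ[nhds x] g := by
    filter_upwards [ψ.eventuallyEq_one] with y hy
    simp [hy]
  have hd : MDifferentiableAt I 𝓘(ℝ, E) (extChartAt I x) x :=
    mdifferentiableAt_extChartAt (mem_chart_source H x)
  have h2 : HasMFDerivAt I 𝓘(ℝ, ℝ) g x (l'.comp (mfderiv I 𝓘(ℝ, E) (extChartAt I x) x)) := by
    have h3 : HasFDerivAt (fun z : E ↦ l' (z - extChartAt I x x)) l' (extChartAt I x x) := by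
      simpa [map_sub] using l'.hasFDerivAt.sub_const (l' (extChartAt I x x))
    exact h3.hasMFDerivAt.comp x hd.hasMFDerivAt
  ext u
  simp only [mvfderiv, h1.mfderiv_eq, h2.mfderiv]
  rw [← hA]
  exact congrArg l (A.symm_apply_apply u)

variable [RiemannianBundle (fun x : M ↦ TangentSpace I x)]
  [IsContMDiffRiemannianBundle I ∞ E (fun x : M ↦ TangentSpace I x)]

/-! ### Smoothness and calculus of the Levi-Civita connection -/

section Connection

variable {X X' Y Y' Z : Π x : M, TangentSpace I x} {f : M → ℝ}

theorem SmoothField.metric (hX : SmoothField I X) (hY : SmoothField I Y) :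
    ContMDiff I 𝓘(ℝ, ℝ) ∞ (metric I X Y) :=
  ContMDiff.inner_bundle (b := id) hX hY

/-- A vector field is smooth as soon as its inner products with smooth fields are smooth: by
Cramer's rule, its coefficients in a frame are rational functions of these inner products and of
the entries of the Gram matrix of the frame. -/
theorem smoothField_of_metric [T2Space M]
    (h : ∀ W, SmoothField I W → ContMDiff I 𝓘(ℝ, ℝ) ∞ (RiemGeom.metric I Z W)) :
    SmoothField I Z := by
  intro x
  obtain ⟨F⟩ := nonempty_cutoffFrame (I := I) x
  let G (y : M) : Matrix (Fin (Module.finrank ℝ E)) (Fin (Module.finrank ℝ E)) ℝ :=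
    fun i j ↦ RiemGeom.metric I (F.field i) (F.field j) y
  let b (y : M) (i : Fin (Module.finrank ℝ E)) : ℝ := RiemGeom.metric I Z (F.field i) y
  have det_smooth (A : M → Matrix (Fin (Module.finrank ℝ E)) (Fin (Module.finrank ℝ E)) ℝ)
      (hA : ∀ i j, ContMDiff I 𝓘(ℝ, ℝ) ∞ fun y ↦ A y i j) :
      ContMDiff I 𝓘(ℝ, ℝ) ∞ fun y ↦ (A y).det := by
    simp only [Matrix.det_apply]
    exact contMDiff_finsetSum fun σ _ ↦
      (contMDiff_const (c := ((Equiv.Perm.sign σ : ℤ) : ℝ))).mul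
        (contMDiff_finsetProd (t := Finset.univ) fun i _ ↦ hA (σ i) i) |>.congr fun y ↦ by
          simp [Units.smul_def]
  have hG : ∀ i j, ContMDiff I 𝓘(ℝ, ℝ) ∞ fun y ↦ G y i j := fun i j ↦
    (F.smooth_field i).metric (F.smooth_field j)
  have hnear : ∀ᶠ y in nhds x, (G y).det ≠ 0 ∧
      Z y = ∑ i, ((G y).det⁻¹ * (Matrix.cramer (G y) (b y)) i) • F.field i y := by
    filter_upwards [F.eventually_cutoff, F.dual] with y hy hdual
    have hdet : (G y).det ≠ 0 := by
      intro h0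
      obtain ⟨v, hv, hGv⟩ := Matrix.exists_mulVec_eq_zero_iff.2 h0
      have hw : ∑ j, v j • F.field j y = 0 := by
        rw [← inner_self_eq_zero (𝕜 := ℝ), sum_inner]
        refine Finset.sum_eq_zero fun i _ ↦ ?_
        have := congrFun hGv i
        simp only [Matrix.mulVec, dotProduct, G, RiemGeom.metric, Pi.zero_apply] at this
        simp only [inner_smul_left, inner_sum, inner_smul_right, RCLike.conj_to_real]
        rw [← mul_zero (v i), ← this, Finset.mul_sum]
        exact Finset.sum_congr rfl fun j _ ↦ by ring
      refine hv (funext fun i ↦ ?_)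
      have := congrArg (F.coeff i y) hw
      simpa [hdual] using this
    refine ⟨hdet, ?_⟩
    have hZ := F.expand y (Z y)
    rw [hy, one_smul] at hZ
    have hb : b y = (G y).mulVec (fun i ↦ F.coeff i y (Z y)) := by
      ext i
      simp only [b, RiemGeom.metric]
      conv_lhs => rw [hZ]
      simp only [sum_inner, inner_smul_left, RCLike.conj_to_real, Matrix.mulVec, dotProduct, G,
        RiemGeom.metric]
      exact Finset.sum_congr rfl fun j _ ↦ by rw [real_inner_comm, mul_comm]
    rw [hb, Matrix.cramer_eq_adjugate_mulVec, Matrix.mulVec_mulVec, Matrix.adjugate_mul,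
      Matrix.smul_mulVec, Matrix.one_mulVec]
    conv_lhs => rw [hZ]
    simp [hdet]
  have hsm : ContMDiffAt I I.tangent ∞ (fun y ↦ (⟨y, ∑ i, ((G y).det⁻¹ *
      (Matrix.cramer (G y) (b y)) i) • F.field i y⟩ : TangentBundle I M)) x := by
    refine ContMDiffAt.sum_section fun i _ ↦ ContMDiffAt.smul_section ?_ (F.smooth_field i x)
    refine ((det_smooth G hG x).inv₀ hnear.self_of_nhds.1).mul ?_
    simp only [Matrix.cramer_apply]
    refine det_smooth _ (fun j k ↦ ?_) x
    by_cases hk : k = i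
    · simpa [Matrix.updateCol_apply, hk] using h _ (F.smooth_field j)
    · simpa [Matrix.updateCol_apply, hk] using hG j k
  refine hsm.congr_of_eventuallyEq ?_
  filter_upwards [hnear] with y hy
  exact congrArg (fun v ↦ (⟨y, v⟩ : TangentBundle I M)) hy.2

/-- The vector field `∇_X Y`. -/
def covDeriv (X Y : Π x : M, TangentSpace I x) (x : M) : TangentSpace I x :=
  leviCivita I M Y x (X x)

theorem SmoothField.koszul (hX : SmoothField I X) (hY : SmoothField I Y) (hZ : SmoothField I Z) :
    ContMDiff I 𝓘(ℝ, ℝ) ∞ (koszul I X Y Z) :=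
  contMDiff_const.mul ((((((hX.dirDeriv (hY.metric hZ)).add (hY.dirDeriv (hX.metric hZ))).sub
    (hZ.dirDeriv (hX.metric hY))).add ((hX.mlieBracket hY).metric hZ)).sub
    ((hX.mlieBracket hZ).metric hY)).sub ((hY.mlieBracket hZ).metric hX))

theorem SmoothField.covDeriv [T2Space M] (hX : SmoothField I X) (hY : SmoothField I Y) :
    SmoothField I (covDeriv X Y) := by
  refine smoothField_of_metric fun W hW ↦ ?_
  rw [show RiemGeom.metric I (RiemGeom.covDeriv X Y) W = RiemGeom.koszul I X Y W from
    funext fun x ↦ inner_leviCivitaFun (hX.mdiff x) (hY.mdiff x) (hW.mdiff x)]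
  exact hX.koszul hY hW

theorem covDeriv_add_left : covDeriv (X + X') Y = covDeriv X Y + covDeriv X' Y := by
  ext x; simp [covDeriv]

theorem covDeriv_sub_left : covDeriv (X - X') Y = covDeriv X Y - covDeriv X' Y := by
  ext x; simp [covDeriv]

theorem covDeriv_smul_left : covDeriv (f • X) Y = f • covDeriv X Y := by
  ext x; simp [covDeriv]

theorem covDeriv_add (hY : SmoothField I Y) (hY' : SmoothField I Y') :
    covDeriv X (Y + Y') = covDeriv X Y + covDeriv X Y' := by
  ext x
  exact congrArg (· (X x))
    ((leviCivita I M).isCovariantDerivativeOnUniv.add (hY.mdiff x) (hY'.mdiff x))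

theorem covDeriv_smul (hf : ContMDiff I 𝓘(ℝ, ℝ) ∞ f) (hY : SmoothField I Y) :
    covDeriv X (f • Y) = f • covDeriv X Y + dirDeriv I X f • Y := by
  ext x
  exact congrArg (· (X x)) ((leviCivita I M).isCovariantDerivativeOnUniv.leibniz (hY.mdiff x)
    ((hf x).mdifferentiableAt (by simp)))

theorem covDeriv_neg (hY : SmoothField I Y) : covDeriv X (-Y) = - covDeriv X Y := by
  ext x
  have := (leviCivita I M).isCovariantDerivativeOnUniv.smul_const (-1 : ℝ) (hY.mdiff x)
  simpa [covDeriv] using! congrArg (· (X x)) this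

theorem SmoothField.neg (hY : SmoothField I Y) : SmoothField I (-Y) :=
  ContMDiff.neg_section hY

theorem covDeriv_sub (hY : SmoothField I Y) (hY' : SmoothField I Y') :
    covDeriv X (Y - Y') = covDeriv X Y - covDeriv X Y' := by
  rw [sub_eq_add_neg, covDeriv_add hY hY'.neg, covDeriv_neg hY', sub_eq_add_neg]

theorem covDeriv_sub_covDeriv (hX : SmoothField I X) (hY : SmoothField I Y) :
    covDeriv X Y - covDeriv Y X = mlieBracket I X Y := by
  ext x
  exact (CovariantDerivative.torsion_eq_zero_iff _).1 leviCivita_torsion (hX.mdiff x) (hY.mdiff x)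

theorem dirDeriv_metric (hX : SmoothField I X) (hY : SmoothField I Y) (hZ : SmoothField I Z) :
    dirDeriv I X (metric I Y Z) = metric I (covDeriv X Y) Z + metric I Y (covDeriv X Z) := by
  ext x
  exact leviCivita_metric (hX.mdiff x) (hY.mdiff x) (hZ.mdiff x)

end Connection

/-! ### The curvature tensor -/

section Curvature

variable {X X' Y Y' Z Z' W : Π x : M, TangentSpace I x} {f : M → ℝ}

theorem curvature_eq : curvature I M X Y Z
    = covDeriv X (covDeriv Y Z) - covDeriv Y (covDeriv X Z) - covDeriv (mlieBracket I X Y) Z :=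
  rfl

theorem SmoothField.curvature [T2Space M] (hX : SmoothField I X) (hY : SmoothField I Y)
    (hZ : SmoothField I Z) : SmoothField I (curvature I M X Y Z) :=
  ((hX.covDeriv (hY.covDeriv hZ)).sub (hY.covDeriv (hX.covDeriv hZ))).sub
    ((hX.mlieBracket hY).covDeriv hZ)

theorem curvature_swap : curvature I M X Y Z = - curvature I M Y X Z := by
  have h : covDeriv (mlieBracket I X Y) Z = - covDeriv (mlieBracket I Y X) Z := by
    ext x
    rw [mlieBracket_swap]
    simp [covDeriv]
  rw [curvature_eq, curvature_eq, h]
  abel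

theorem curvature_add_left [T2Space M] (hX : SmoothField I X) (hX' : SmoothField I X')
    (hZ : SmoothField I Z) :
    curvature I M (X + X') Y Z = curvature I M X Y Z + curvature I M X' Y Z := by
  have h : mlieBracket I (X + X') Y = mlieBracket I X Y + mlieBracket I X' Y := by
    ext x; exact mlieBracket_add_left (hX.mdiff x) (hX'.mdiff x)
  simp only [curvature_eq, h, covDeriv_add_left, covDeriv_add (hX.covDeriv hZ) (hX'.covDeriv hZ)]
  abel

theorem curvature_smul_left [T2Space M] (hf : ContMDiff I 𝓘(ℝ, ℝ) ∞ f) (hX : SmoothField I X)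
    (hZ : SmoothField I Z) : curvature I M (f • X) Y Z = f • curvature I M X Y Z := by
  have h : mlieBracket I (f • X) Y = f • mlieBracket I X Y - dirDeriv I Y f • X := by
    ext x
    rw [mlieBracket_smul_left ((hf x).mdifferentiableAt (by simp)) (hX.mdiff x)]
    simp [dirDeriv, sub_eq_neg_add]
  simp only [curvature_eq, h, covDeriv_sub_left, covDeriv_smul_left,
    covDeriv_smul hf (hX.covDeriv hZ)]
  ext x
  simp only [Pi.sub_apply, Pi.add_apply, Pi.smul_apply']
  module

theorem curvature_add_right [T2Space M] (hX : SmoothField I X) (hY : SmoothField I Y)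
    (hZ : SmoothField I Z) (hZ' : SmoothField I Z') :
    curvature I M X Y (Z + Z') = curvature I M X Y Z + curvature I M X Y Z' := by
  simp only [curvature_eq, covDeriv_add hZ hZ', covDeriv_add (hX.covDeriv hZ) (hX.covDeriv hZ'),
    covDeriv_add (hY.covDeriv hZ) (hY.covDeriv hZ')]
  abel

theorem curvature_smul_right [T2Space M] (hX : SmoothField I X) (hY : SmoothField I Y)
    (hf : ContMDiff I 𝓘(ℝ, ℝ) ∞ f) (hZ : SmoothField I Z) :
    curvature I M X Y (f • Z) = f • curvature I M X Y Z := by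
  have hXf := hX.dirDeriv hf
  have hYf := hY.dirDeriv hf
  simp only [curvature_eq, covDeriv_smul hf hZ,
    covDeriv_add ((hX.covDeriv hZ).smul hf) (hZ.smul hXf),
    covDeriv_add ((hY.covDeriv hZ).smul hf) (hZ.smul hYf), covDeriv_smul hf (hX.covDeriv hZ),
    covDeriv_smul hf (hY.covDeriv hZ), covDeriv_smul hXf hZ, covDeriv_smul hYf hZ,
    dirDeriv_mlieBracket hX hY hf]
  ext x
  simp only [Pi.sub_apply, Pi.add_apply, Pi.smul_apply']
  module

theorem covDeriv_congr {x : M} (hX : X' x = X x) (hY : SmoothField I Y)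
    (h : ∀ᶠ y in nhds x, Y' y = Y y) : covDeriv X' Y' x = covDeriv X Y x := by
  have hY' : MDiffAt (T% Y') x := (hY.mdiff x).congr_of_eventuallyEq <| by
    filter_upwards [h] with y hy using congrArg (fun v ↦ (⟨y, v⟩ : TangentBundle I M)) hy
  simp only [covDeriv, hX]
  exact congrArg (· (X x)) ((leviCivita I M).isCovariantDerivativeOnUniv.congr_of_eventuallyEq
    hY' (hY.mdiff x) Filter.univ_mem h)

theorem curvature_congr [T2Space M] {x : M} (hX : SmoothField I X) (hY : SmoothField I Y)
    (hZ : SmoothField I Z) (hXX' : ∀ᶠ y in nhds x, X' y = X y)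
    (hYY' : ∀ᶠ y in nhds x, Y' y = Y y) (hZZ' : ∀ᶠ y in nhds x, Z' y = Z y) :
    curvature I M X' Y' Z' x = curvature I M X Y Z x := by
  have aux {V V' : Π x : M, TangentSpace I x} (h : ∀ᶠ y in nhds x, V' y = V y) :
      ∀ᶠ y in nhds x, covDeriv V' Z' y = covDeriv V Z y := by
    filter_upwards [h, eventually_eventually_nhds.2 hZZ'] with y h1 h2
    exact covDeriv_congr h1 hZ h2
  simp only [curvature_eq, Pi.sub_apply]
  rw [covDeriv_congr hXX'.self_of_nhds (hY.covDeriv hZ) (aux hYY'),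
    covDeriv_congr hYY'.self_of_nhds (hX.covDeriv hZ) (aux hXX'),
    covDeriv_congr (Filter.EventuallyEq.mlieBracket_vectorField_eq hXX' hYY') hZ hZZ']

/-- The curvature tensor is computed by arbitrary smooth extensions of the three vectors. -/
theorem riemann_apply [T2Space M] (hX : SmoothField I X) (hY : SmoothField I Y)
    (hZ : SmoothField I Z) (x : M) :
    riemann x (X x) (Y x) (Z x) = curvature I M X Y Z x := by
  have left {X X' Y Z : Π x : M, TangentSpace I x} (hX : SmoothField I X) (hX' : SmoothField I X')
      (hZ : SmoothField I Z) (h : X x = X' x) :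
      curvature I M X Y Z x = curvature I M X' Y Z x := by
    obtain ⟨L, hL⟩ := exists_linearMap_of_tensorial (x := x)
      (Φ := fun V ↦ curvature I M V Y Z x)
      (fun V V' hV hV' ↦ congrFun (curvature_add_left hV hV' hZ) x)
      (fun f V hf hV ↦ congrFun (curvature_smul_left hf hV hZ) x)
    rw [hL X hX, hL X' hX', h]
  -- The three arguments are exchanged one by one, the second through the antisymmetry in the first
  -- two.
  obtain ⟨X', hX', hX'e⟩ := exists_smoothField_extend (X x)
  obtain ⟨Y', hY', hY'e⟩ := exists_smoothField_extend (Y x)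
  obtain ⟨Z', hZ', hZ'e⟩ := exists_smoothField_extend (Z x)
  obtain ⟨L, hL⟩ := exists_linearMap_of_tensorial (x := x)
    (Φ := fun V ↦ curvature I M X Y V x)
    (fun V V' hV hV' ↦ congrFun (curvature_add_right hX hY hV hV') x)
    (fun f V hf hV ↦ congrFun (curvature_smul_right hX hY hf hV) x)
  have eX : X' x = X x := by simpa using hX'e.self_of_nhds
  have eY : Y' x = Y x := by simpa using hY'e.self_of_nhds
  have eZ : Z' x = Z x := by simpa using hZ'e.self_of_nhds
  rw [riemann, curvature_congr hX' hY' hZ' (hX'e.mono fun _ h ↦ h.symm)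
    (hY'e.mono fun _ h ↦ h.symm) (hZ'e.mono fun _ h ↦ h.symm), left hX' hX hZ' eX, curvature_swap,
    Pi.neg_apply, left hY' hY hZ' eY, ← Pi.neg_apply, ← curvature_swap, hL Z' hZ', hL Z hZ, eZ]

section Linear

variable [T2Space M] (x : M)

theorem riemann_add_left (u u' v w : TangentSpace I x) :
    riemann x (u + u') v w = riemann x u v w + riemann x u' v w := by
  obtain ⟨X, hX, rfl⟩ := exists_smoothField_apply_eq u
  obtain ⟨X', hX', rfl⟩ := exists_smoothField_apply_eq u'
  obtain ⟨Y, hY, rfl⟩ := exists_smoothField_apply_eq v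
  obtain ⟨Z, hZ, rfl⟩ := exists_smoothField_apply_eq w
  rw [← Pi.add_apply, riemann_apply (hX.add hX') hY hZ, curvature_add_left hX hX' hZ,
    riemann_apply hX hY hZ, riemann_apply hX' hY hZ, Pi.add_apply]

theorem riemann_smul_left (c : ℝ) (u v w : TangentSpace I x) :
    riemann x (c • u) v w = c • riemann x u v w := by
  obtain ⟨X, hX, rfl⟩ := exists_smoothField_apply_eq u
  obtain ⟨Y, hY, rfl⟩ := exists_smoothField_apply_eq v
  obtain ⟨Z, hZ, rfl⟩ := exists_smoothField_apply_eq w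
  have hc : ContMDiff I 𝓘(ℝ, ℝ) ∞ (fun _ : M ↦ c) := contMDiff_const
  have := riemann_apply (hX.smul hc) hY hZ x
  rw [curvature_smul_left hc hX hZ] at this
  rw [riemann_apply hX hY hZ]
  exact this

theorem riemann_swap (u v w : TangentSpace I x) : riemann x u v w = - riemann x v u w := by
  obtain ⟨X, hX, rfl⟩ := exists_smoothField_apply_eq u
  obtain ⟨Y, hY, rfl⟩ := exists_smoothField_apply_eq v
  obtain ⟨Z, hZ, rfl⟩ := exists_smoothField_apply_eq w
  rw [riemann_apply hX hY hZ, riemann_apply hY hX hZ, curvature_swap, Pi.neg_apply]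

theorem riemann_add_right (u v w w' : TangentSpace I x) :
    riemann x u v (w + w') = riemann x u v w + riemann x u v w' := by
  obtain ⟨X, hX, rfl⟩ := exists_smoothField_apply_eq u
  obtain ⟨Y, hY, rfl⟩ := exists_smoothField_apply_eq v
  obtain ⟨Z, hZ, rfl⟩ := exists_smoothField_apply_eq w
  obtain ⟨Z', hZ', rfl⟩ := exists_smoothField_apply_eq w'
  rw [← Pi.add_apply, riemann_apply hX hY (hZ.add hZ'), curvature_add_right hX hY hZ hZ',
    riemann_apply hX hY hZ, riemann_apply hX hY hZ', Pi.add_apply]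

theorem riemann_smul_right (c : ℝ) (u v w : TangentSpace I x) :
    riemann x u v (c • w) = c • riemann x u v w := by
  obtain ⟨X, hX, rfl⟩ := exists_smoothField_apply_eq u
  obtain ⟨Y, hY, rfl⟩ := exists_smoothField_apply_eq v
  obtain ⟨Z, hZ, rfl⟩ := exists_smoothField_apply_eq w
  have hc : ContMDiff I 𝓘(ℝ, ℝ) ∞ (fun _ : M ↦ c) := contMDiff_const
  have := riemann_apply hX hY (hZ.smul hc) x
  rw [curvature_smul_right hX hY hc hZ] at this
  rw [riemann_apply hX hY hZ]
  exact this

variable {x} in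
/-- The endomorphism `u ↦ R(u, v)w`, whose trace is `Ric(v, w)`. -/
def riemannEnd (v w : TangentSpace I x) : TangentSpace I x →ₗ[ℝ] TangentSpace I x where
  toFun u := riemann x u v w
  map_add' u u' := riemann_add_left x u u' v w
  map_smul' c u := riemann_smul_left x c u v w

theorem ricci_eq_trace (v w : TangentSpace I x) :
    ricci x v w = LinearMap.trace ℝ _ (riemannEnd v w) := by
  rw [LinearMap.trace_eq_sum_inner _ (stdOrthonormalBasis ℝ (TangentSpace I x))]
  exact Finset.sum_congr rfl fun i _ ↦ real_inner_comm _ _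

theorem ricci_add_left (v v' w : TangentSpace I x) :
    ricci x (v + v') w = ricci x v w + ricci x v' w := by
  simp only [ricci, riemann_swap x _ (v + v'), riemann_add_left, inner_neg_left, inner_add_left,
    Finset.sum_add_distrib, riemann_swap x _ v, riemann_swap x _ v', neg_add]

theorem ricci_smul_left (c : ℝ) (v w : TangentSpace I x) :
    ricci x (c • v) w = c * ricci x v w := by
  simp only [ricci, riemann_swap x _ (c • v), riemann_smul_left, inner_neg_left, inner_smul_left,
    Finset.mul_sum, riemann_swap x _ v, RCLike.conj_to_real, mul_neg]

theorem ricci_add_right (v w w' : TangentSpace I x) :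
    ricci x v (w + w') = ricci x v w + ricci x v w' := by
  simp only [ricci, riemann_add_right, inner_add_left, Finset.sum_add_distrib]

theorem ricci_smul_right (c : ℝ) (v w : TangentSpace I x) :
    ricci x v (c • w) = c * ricci x v w := by
  simp only [ricci, riemann_smul_right, inner_smul_left, Finset.mul_sum, RCLike.conj_to_real]

/-- The Ricci operator at `x` as a linear map. -/
def ricciEnd : TangentSpace I x →ₗ[ℝ] TangentSpace I x where
  toFun v := ricciOperator x v
  map_add' v v' := by
    simp only [ricciOperator, ricci_add_left, add_smul, Finset.sum_add_distrib]
  map_smul' c v := by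
    simp only [ricciOperator, ricci_smul_left, mul_smul, Finset.smul_sum, RingHom.id_apply]

theorem inner_ricciOperator (v w : TangentSpace I x) :
    inner ℝ (ricciOperator x v) w = ricci x v w := by
  let L : TangentSpace I x →ₗ[ℝ] ℝ :=
    { toFun := ricci x v
      map_add' := ricci_add_right x v
      map_smul' := fun c ↦ ricci_smul_right x c v }
  let b := stdOrthonormalBasis ℝ (TangentSpace I x)
  change inner ℝ (∑ i, L (b i) • b i) w = L w
  conv_rhs => rw [← b.sum_repr' w]
  simp only [sum_inner, inner_smul_left, map_sum, map_smul, smul_eq_mul, RCLike.conj_to_real]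
  exact Finset.sum_congr rfl fun i _ ↦ mul_comm _ _

theorem scal_eq_trace : scal I x = LinearMap.trace ℝ _ (ricciEnd (I := I) x) := by
  rw [LinearMap.trace_eq_sum_inner _ (stdOrthonormalBasis ℝ (TangentSpace I x))]
  refine Finset.sum_congr rfl fun i _ ↦ ?_
  rw [real_inner_comm]
  exact (inner_ricciOperator x _ _).symm

end Linear

/-- The metric antisymmetry of the curvature, `g(R(X, Y)Z, W) = - g(R(X, Y)W, Z)`. -/
theorem metric_curvature_swap [T2Space M] (hX : SmoothField I X) (hY : SmoothField I Y)
    (hZ : SmoothField I Z) (hW : SmoothField I W) :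
    metric I (curvature I M X Y Z) W = - metric I (curvature I M X Y W) Z := by
  have hXY := hX.mlieBracket hY
  have h0 := dirDeriv_mlieBracket hX hY (hZ.metric hW)
  have hXW := hX.covDeriv hW
  have hYW := hY.covDeriv hW
  have hXZ := hX.covDeriv hZ
  have hYZ := hY.covDeriv hZ
  have dadd {V : Π x : M, TangentSpace I x} {f g : M → ℝ} (hf : ContMDiff I 𝓘(ℝ, ℝ) ∞ f)
      (hg : ContMDiff I 𝓘(ℝ, ℝ) ∞ g) :
      dirDeriv I V (f + g) = dirDeriv I V f + dirDeriv I V g := by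
    ext x
    simp only [dirDeriv, Pi.add_apply]
    rw [mvfderiv_add ((hf x).mdifferentiableAt (by simp)) ((hg x).mdifferentiableAt (by simp))]
    rfl
  rw [dirDeriv_metric hXY hZ hW, dirDeriv_metric hX hZ hW, dirDeriv_metric hY hZ hW,
    dadd (hXZ.metric hW) (hZ.metric hXW), dadd (hYZ.metric hW) (hZ.metric hYW),
    dirDeriv_metric hX hYZ hW, dirDeriv_metric hX hZ hYW, dirDeriv_metric hY hXZ hW,
    dirDeriv_metric hY hZ hXW] at h0
  ext x
  have h1 := congrFun h0 x
  simp only [metric, Pi.add_apply, Pi.sub_apply, Pi.neg_apply, curvature_eq, inner_sub_left]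
    at h1 ⊢
  simp only [real_inner_comm (Z x)] at h1 ⊢
  linarith

end Curvature

/-! ### Normal extensions and derivatives of traces -/

section Normal

variable {X W : Π x : M, TangentSpace I x} {x : M}

theorem dirDeriv_sum {ι : Type*} (s : Finset ι) {f : ι → M → ℝ}
    (hf : ∀ i, ContMDiff I 𝓘(ℝ, ℝ) ∞ (f i)) :
    dirDeriv I W (fun y ↦ ∑ i ∈ s, f i y) x = ∑ i ∈ s, dirDeriv I W (f i) x := by
  induction s using Finset.cons_induction with
  | empty =>
    simp only [Finset.sum_empty, dirDeriv, mvfderiv_const, _root_.zero_apply]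
  | cons i s hi ih =>
    simp only [Finset.sum_cons, ← ih]
    simp only [dirDeriv]
    rw [← _root_.add_apply, ← mvfderiv_add ((hf i x).mdifferentiableAt (by simp))
      ((contMDiff_finsetSum (t := s) (fun i _ ↦ hf i) x).mdifferentiableAt (by simp))]
    rfl

theorem covDeriv_sum {ι : Type*} (s : Finset ι) {Y : ι → Π y : M, TangentSpace I y}
    (hY : ∀ i, SmoothField I (Y i)) :
    covDeriv W (fun y ↦ ∑ i ∈ s, Y i y) x = ∑ i ∈ s, covDeriv W (Y i) x := by
  induction s using Finset.cons_induction with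
  | empty =>
    simp only [Finset.sum_empty]
    change (leviCivita I M) 0 x (W x) = 0
    simp
  | cons i s hi ih =>
    simp only [Finset.sum_cons, ← ih]
    exact congrFun (covDeriv_add (hY i) (SmoothField.sum hY)) x

/-- Every tangent vector extends to a vector field whose covariant derivative vanishes at the given
point. -/
theorem exists_normal_extension [T2Space M] (v : TangentSpace I x) :
    ∃ X : Π y : M, TangentSpace I y, SmoothField I X ∧ X x = v ∧ leviCivita I M X x = 0 := by
  obtain ⟨σ, hσ, rfl⟩ := exists_smoothField_apply_eq v
  obtain ⟨F⟩ := nonempty_cutoffFrame (I := I) x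
  -- Subtract the combination of the frame fields whose coefficients vanish at `x` and have the
  -- components of `∇σ` as differentials there.
  choose a ha ha0 hda using fun i ↦ exists_contMDiff_mvfderiv_eq (I := I) (x := x)
    ((LinearMap.toContinuousLinearMap (F.coeff i x)).comp (leviCivita I M σ x))
  have haF i : SmoothField I (a i • F.field i) := (F.smooth_field i).smul (ha i)
  refine ⟨σ - fun y ↦ ∑ i, (a i • F.field i) y, hσ.sub (.sum haF), by simp [ha0], ?_⟩
  ext u
  obtain ⟨U, hU, rfl⟩ := exists_smoothField_apply_eq u
  have h := F.expand x (leviCivita I M σ x (U x))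
  rw [F.eventually_cutoff.self_of_nhds, one_smul] at h
  have h1 := congrFun (covDeriv_sub (X := U) hσ (.sum (s := Finset.univ) haF)) x
  rw [Pi.sub_apply, covDeriv_sum _ haF] at h1
  refine h1.trans ?_
  rw [_root_.zero_apply, sub_eq_zero, covDeriv, h]
  refine Finset.sum_congr rfl fun i _ ↦ ?_
  rw [covDeriv_smul (ha i) (F.smooth_field i)]
  simp [ha0, dirDeriv, hda]

theorem CutoffFrame.trace_eq {x y : M} (F : CutoffFrame I x) (hy : F.cutoff y = 1)
    (T : TangentSpace I y →ₗ[ℝ] TangentSpace I y) :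
    LinearMap.trace ℝ _ T = ∑ i, F.coeff i y (T (F.field i y)) := by
  have hT : T = ∑ i, (F.coeff i y).smulRight (T (F.field i y)) := by
    ext v
    have h := F.expand y v
    rw [hy, one_smul] at h
    conv_lhs => rw [h]
    simp
  conv_lhs => rw [hT]
  simp [LinearMap.trace_smulRight]

variable {T : Π y : M, TangentSpace I y →ₗ[ℝ] TangentSpace I y}

theorem contMDiff_trace [T2Space M] (hT : ∀ X, SmoothField I X → SmoothField I fun y ↦ T y (X y)) :
    ContMDiff I 𝓘(ℝ, ℝ) ∞ fun y ↦ LinearMap.trace ℝ _ (T y) := by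
  intro x
  obtain ⟨F⟩ := nonempty_cutoffFrame (I := I) x
  have h : ContMDiff I 𝓘(ℝ, ℝ) ∞ fun y ↦ ∑ i, F.coeff i y (T y (F.field i y)) :=
    contMDiff_finsetSum fun i _ ↦ F.contMDiff_coeff i _ (hT _ (F.smooth_field i))
  refine (h x).congr_of_eventuallyEq ?_
  filter_upwards [F.eventually_cutoff] with y hy using F.trace_eq hy _

/-- The Leibniz rule for the expansion of `X` in a frame; the cutoff factor does not contribute,
since it is constant near `x`. -/
theorem CutoffFrame.coeff_covDeriv (F : CutoffFrame I x) (hX : SmoothField I X)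
    (i : Fin (Module.finrank ℝ E)) :
    F.coeff i x (covDeriv W X x) = dirDeriv I W (fun y ↦ F.coeff i y (X y)) x
      + ∑ j, F.coeff j x (X x) * F.coeff i x (covDeriv W (F.field j) x) := by
  have h1 : covDeriv W (F.cutoff • X) x = covDeriv W X x :=
    covDeriv_congr rfl hX <| by
      filter_upwards [F.eventually_cutoff] with y hy
      simp [hy]
  have hc j : SmoothField I ((fun y ↦ F.coeff j y (X y)) • F.field j) :=
    (F.smooth_field j).smul (F.contMDiff_coeff j X hX)
  have h2 : F.cutoff • X = fun y ↦ ∑ j, ((fun y ↦ F.coeff j y (X y)) • F.field j) y :=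
    funext fun y ↦ F.expand y (X y)
  rw [← h1, h2, covDeriv_sum _ hc]
  simp only [covDeriv_smul (F.contMDiff_coeff _ X hX) (F.smooth_field _), Pi.add_apply,
    Pi.smul_apply', map_sum, map_add, map_smul, smul_eq_mul, Finset.sum_add_distrib,
    F.dual.self_of_nhds, mul_ite, mul_one, mul_zero, Finset.sum_ite_eq, Finset.mem_univ, if_true]
  rw [add_comm]

/-- The derivative of a trace is the trace of the covariant derivative, evaluated in an orthonormal
basis that is extended by fields with vanishing covariant derivative at the point. -/
theorem dirDeriv_trace [T2Space M] (hT : ∀ X, SmoothField I X → SmoothField I fun y ↦ T y (X y))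
    {κ : Type*} [Fintype κ] (b : OrthonormalBasis κ ℝ (TangentSpace I x))
    {e : κ → Π y : M, TangentSpace I y} (he : ∀ k, SmoothField I (e k)) (heb : ∀ k, e k x = b k)
    (hne : ∀ k, leviCivita I M (e k) x = 0) :
    dirDeriv I W (fun y ↦ LinearMap.trace ℝ _ (T y)) x
      = ∑ k, inner ℝ (covDeriv W (fun y ↦ T y (e k y)) x) (b k) := by
  -- `L` is the covariant derivative `∇_W T`; its trace is computed in the frame and in `b`.
  obtain ⟨L, hL⟩ := exists_linearMap_of_tensorial (I := I) (x := x)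
    (Φ := fun X ↦ covDeriv W (fun y ↦ T y (X y)) x - T x (covDeriv W X x))
    (fun X Y hX hY ↦ by
      have : (fun y ↦ T y ((X + Y) y)) = (fun y ↦ T y (X y)) + fun y ↦ T y (Y y) := by
        ext y; simp
      rw [this, covDeriv_add (hT X hX) (hT Y hY), covDeriv_add hX hY, Pi.add_apply, Pi.add_apply,
        map_add]
      abel)
    (fun f X hf hX ↦ by
      have : (fun y ↦ T y ((f • X) y)) = f • (fun y ↦ T y (X y)) := by
        ext y; simp
      rw [this, covDeriv_smul hf (hT X hX), covDeriv_smul hf hX]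
      simp only [Pi.add_apply, Pi.smul_apply', map_add, map_smul]
      module)
  obtain ⟨F⟩ := nonempty_cutoffFrame (I := I) x
  have hF1 := F.eventually_cutoff.self_of_nhds
  have h1 : LinearMap.trace ℝ _ L = ∑ k, inner ℝ (covDeriv W (fun y ↦ T y (e k y)) x) (b k) := by
    rw [LinearMap.trace_eq_sum_inner _ b]
    refine Finset.sum_congr rfl fun k _ ↦ ?_
    rw [real_inner_comm, ← heb k, ← hL _ (he k)]
    simp [covDeriv, hne]
  have h2 : (fun y ↦ LinearMap.trace ℝ _ (T y))
      =ᶠ[nhds x] fun y ↦ ∑ i, F.coeff i y (T y (F.field i y)) := by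
    filter_upwards [F.eventually_cutoff] with y hy using F.trace_eq hy _
  have h3 : dirDeriv I W (fun y ↦ LinearMap.trace ℝ _ (T y)) x
      = dirDeriv I W (fun y ↦ ∑ i, F.coeff i y (T y (F.field i y))) x := by
    simp only [dirDeriv, mvfderiv, h2.mfderiv_eq]
    rfl
  have h4 (j : Fin (Module.finrank ℝ E)) : F.coeff j x (T x (covDeriv W (F.field j) x))
      = ∑ i, F.coeff i x (covDeriv W (F.field j) x) * F.coeff j x (T x (F.field i x)) := by
    have h := F.expand x (covDeriv W (F.field j) x)
    rw [hF1, one_smul] at h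
    conv_lhs => rw [h]
    simp
  rw [← h1, h3, dirDeriv_sum _ fun i ↦ F.contMDiff_coeff i _ (hT _ (F.smooth_field i)),
    F.trace_eq hF1]
  simp only [← hL _ (F.smooth_field _), map_sub, F.coeff_covDeriv (hT _ (F.smooth_field _)), h4,
    Finset.sum_sub_distrib, Finset.sum_add_distrib]
  -- The two double sums, coming from the derivatives of the frame fields, cancel.
  rw [Finset.sum_comm (f := fun i j ↦ F.coeff j x (T x (F.field i x)) * _), eq_comm,
    add_sub_assoc, add_eq_left, sub_eq_zero]
  exact Finset.sum_congr rfl fun j _ ↦ Finset.sum_congr rfl fun i _ ↦ mul_comm _ _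

end Normal

/-! ### The contracted second Bianchi identity -/

section Bianchi

variable [T2Space M] {X Y Z U V W : Π x : M, TangentSpace I x} {x : M}

/-- The second Bianchi identity at a point where the covariant derivatives of all fields vanish.
With `R(Y, Z) = [∇_Y, ∇_Z] - ∇_[Y, Z]`, it is the Jacobi identity for operators together with the
one for vector fields. -/
theorem second_bianchi (hX : SmoothField I X) (hY : SmoothField I Y) (hZ : SmoothField I Z)
    (hU : SmoothField I U) (hX0 : leviCivita I M X x = 0) (hY0 : leviCivita I M Y x = 0)
    (hZ0 : leviCivita I M Z x = 0) (hU0 : leviCivita I M U x = 0) :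
    covDeriv X (curvature I M Y Z U) x + covDeriv Y (curvature I M Z X U) x
      + covDeriv Z (curvature I M X Y U) x = 0 := by
  have bracket {A B : Π x : M, TangentSpace I x} (hA : SmoothField I A) (hB : SmoothField I B)
      (hA0 : leviCivita I M A x = 0) (hB0 : leviCivita I M B x = 0) :
      mlieBracket I A B x = 0 := by
    rw [← covDeriv_sub_covDeriv hA hB]
    simp [covDeriv, hA0, hB0]
  -- `R(B, C) ∇_A U` and `R(A, [B, C]) U` vanish at the point.
  have step {A B C : Π x : M, TangentSpace I x} (hA : SmoothField I A) (hB : SmoothField I B)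
      (hC : SmoothField I C) (hB0 : leviCivita I M B x = 0)
      (hC0 : leviCivita I M C x = 0) :
      covDeriv A (curvature I M B C U) x
        = covDeriv A (covDeriv B (covDeriv C U)) x - covDeriv A (covDeriv C (covDeriv B U)) x
          - covDeriv B (covDeriv C (covDeriv A U)) x + covDeriv C (covDeriv B (covDeriv A U)) x
          - leviCivita I M U x (mlieBracket I A (mlieBracket I B C) x) := by
    have hBC := hB.mlieBracket hC
    have h1 : curvature I M B C (covDeriv A U) x = 0 := by
      rw [← riemann_apply hB hC (hA.covDeriv hU), covDeriv, hU0, _root_.zero_apply]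
      simpa using riemann_smul_right x 0 (B x) (C x) 0
    have h2 : curvature I M A (mlieBracket I B C) U x = 0 := by
      rw [← riemann_apply hA hBC hU, bracket hB hC hB0 hC0, riemann_swap]
      simpa using riemann_smul_left x 0 0 (A x) (U x)
    have h3 : curvature I M B C U
        = covDeriv B (covDeriv C U) - covDeriv C (covDeriv B U) - covDeriv (mlieBracket I B C) U :=
      rfl
    rw [h3, covDeriv_sub ((hB.covDeriv (hC.covDeriv hU)).sub (hC.covDeriv (hB.covDeriv hU)))
      (hBC.covDeriv hU), covDeriv_sub (hB.covDeriv (hC.covDeriv hU)) (hC.covDeriv (hB.covDeriv hU))]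
    rw [curvature_eq] at h1 h2
    simp only [Pi.sub_apply] at h1 h2 ⊢
    change _ - _ - leviCivita I M U x (mlieBracket I A (mlieBracket I B C) x) = 0 at h2
    rw [sub_sub, sub_eq_zero] at h1 h2
    rw [h2, h1]
    abel
  have h3 : IsManifold I (minSmoothness ℝ 3) M := by
    rw [minSmoothness_of_isRCLikeNormedField]; infer_instance
  have h2 : minSmoothness ℝ 2 ≤ ∞ := by
    rw [minSmoothness_of_isRCLikeNormedField]
    exact ENat.LEInfty.out
  have jac := leibniz_identity_mlieBracket_apply (𝕜 := ℝ) (x := x)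
    ((hX x).of_le h2) ((hY x).of_le h2) ((hZ x).of_le h2)
  rw [mlieBracket_swap_apply (V := mlieBracket I X Y), mlieBracket_swap (V := X) (W := Z)] at jac
  have e : mlieBracket I Y (-mlieBracket I Z X) x = - mlieBracket I Y (mlieBracket I Z X) x := by
    have := mlieBracket_const_smul_right (I := I) (V := Y) (c := (-1 : ℝ))
      ((hZ.mlieBracket hX).mdiff x)
    simpa using! this
  rw [e] at jac
  rw [step hX hY hZ hY0 hZ0, step hY hZ hX hZ0 hX0, step hZ hX hY hX0 hY0, jac]
  simp only [map_add, map_neg]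
  abel

variable (I) in
/-- A family of vector fields that is orthonormal and has vanishing covariant derivative at `x`. -/
structure NormalFrame (x : M) where
  /-- The fields of the family. -/
  field : Fin (Module.finrank ℝ (TangentSpace I x)) → Π y : M, TangentSpace I y
  smooth : ∀ i, SmoothField I (field i)
  apply_eq : ∀ i, field i x = stdOrthonormalBasis ℝ (TangentSpace I x) i
  leviCivita_eq : ∀ i, leviCivita I M (field i) x = 0

variable (x) in
theorem nonempty_normalFrame : Nonempty (NormalFrame I x) := by
  choose e he he1 he2 using fun i ↦
    exists_normal_extension (I := I) (stdOrthonormalBasis ℝ (TangentSpace I x) i)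
  exact ⟨⟨e, he, he1, he2⟩⟩

/-- The function `Ric(V, W)`. -/
def ricciFun (V W : Π x : M, TangentSpace I x) (x : M) : ℝ := ricci x (V x) (W x)

theorem smoothField_riemannEnd (hV : SmoothField I V) (hW : SmoothField I W)
    (X : Π x : M, TangentSpace I x) (hX : SmoothField I X) :
    SmoothField I fun y ↦ riemannEnd (V y) (W y) (X y) := by
  have : (fun y ↦ riemannEnd (V y) (W y) (X y)) = curvature I M X V W :=
    funext fun y ↦ riemann_apply hX hV hW y
  rw [this]
  exact hX.curvature hV hW

theorem SmoothField.ricciFun (hV : SmoothField I V) (hW : SmoothField I W) :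
    ContMDiff I 𝓘(ℝ, ℝ) ∞ (ricciFun V W) := by
  have : RiemGeom.ricciFun V W = fun y ↦ LinearMap.trace ℝ _ (riemannEnd (V y) (W y)) :=
    funext fun y ↦ ricci_eq_trace y _ _
  rw [this]
  exact contMDiff_trace (smoothField_riemannEnd hV hW)

theorem metric_ricciEnd :
    metric I (fun y ↦ ricciEnd y (V y)) W = ricciFun V W :=
  funext fun y ↦ inner_ricciOperator y _ _

theorem smoothField_ricciEnd (X : Π x : M, TangentSpace I x) (hX : SmoothField I X) :
    SmoothField I fun y ↦ ricciEnd y (X y) := by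
  refine smoothField_of_metric fun W hW ↦ ?_
  rw [metric_ricciEnd]
  exact hX.ricciFun hW

theorem contMDiff_scal : ContMDiff I 𝓘(ℝ, ℝ) ∞ (scal I : M → ℝ) := by
  rw [show (scal I : M → ℝ) = fun y ↦ LinearMap.trace ℝ _ (ricciEnd (I := I) y) from
    funext scal_eq_trace]
  exact contMDiff_trace smoothField_ricciEnd

theorem inner_covDeriv_of_leviCivita_eq_zero (hW : SmoothField I W) (hX : SmoothField I X)
    (hY : SmoothField I Y) (hY0 : leviCivita I M Y x = 0) :
    inner ℝ (covDeriv W X x) (Y x) = dirDeriv I W (metric I X Y) x := by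
  rw [dirDeriv_metric hW hX hY]
  simp [metric, covDeriv, hY0]

namespace NormalFrame

variable (F : NormalFrame I x)

theorem dirDeriv_ricciFun (hV : SmoothField I V) (hW : SmoothField I W) :
    dirDeriv I U (ricciFun V W) x
      = ∑ i, inner ℝ (covDeriv U (curvature I M (F.field i) V W) x) (F.field i x) := by
  have h : ricciFun V W = fun y ↦ LinearMap.trace ℝ _ (riemannEnd (V y) (W y)) :=
    funext fun y ↦ ricci_eq_trace y _ _
  rw [h, dirDeriv_trace (smoothField_riemannEnd hV hW) (stdOrthonormalBasis ℝ (TangentSpace I x))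
    F.smooth F.apply_eq F.leviCivita_eq]
  refine Finset.sum_congr rfl fun i _ ↦ ?_
  rw [F.apply_eq, show (fun y ↦ riemannEnd (V y) (W y) (F.field i y))
    = curvature I M (F.field i) V W from funext fun y ↦ riemann_apply (F.smooth i) hV hW y]

theorem dirDeriv_scal :
    dirDeriv I U (scal I) x
      = ∑ i, inner ℝ (covDeriv U (fun y ↦ ricciEnd y (F.field i y)) x) (F.field i x) := by
  rw [show (scal I : M → ℝ) = fun y ↦ LinearMap.trace ℝ _ (ricciEnd (I := I) y) from
    funext scal_eq_trace, dirDeriv_trace smoothField_ricciEnd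
    (stdOrthonormalBasis ℝ (TangentSpace I x)) F.smooth F.apply_eq F.leviCivita_eq]
  simp only [F.apply_eq]

theorem inner_covDeriv_ricciEnd (hU : SmoothField I U) (hV : SmoothField I V)
    (i : Fin (Module.finrank ℝ (TangentSpace I x))) :
    inner ℝ (covDeriv U (fun y ↦ ricciEnd y (V y)) x) (F.field i x)
      = dirDeriv I U (ricciFun V (F.field i)) x := by
  rw [inner_covDeriv_of_leviCivita_eq_zero hU (smoothField_ricciEnd V hV) (F.smooth i)
    (F.leviCivita_eq i), metric_ricciEnd]

/-- The contracted second Bianchi identity `d scal = 2 div Ric`, in a normal frame. -/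
theorem contracted_bianchi (k : Fin (Module.finrank ℝ (TangentSpace I x))) :
    dirDeriv I (F.field k) (scal I) x
      = 2 * ∑ i, dirDeriv I (F.field i) (ricciFun (F.field k) (F.field i)) x := by
  -- the components `(∇_i R)(e_j, e_k, e_l, e_m)`
  let S i j k l m := inner ℝ (covDeriv (F.field i) (curvature I M (F.field j) (F.field k)
    (F.field l)) x) (F.field m x)
  have cyc i j k l m : S i j k l m + S j k i l m + S k i j l m = 0 := by
    simp only [S, ← inner_add_left]
    rw [second_bianchi (F.smooth i) (F.smooth j) (F.smooth k) (F.smooth l) (F.leviCivita_eq i)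
      (F.leviCivita_eq j) (F.leviCivita_eq k) (F.leviCivita_eq l), inner_zero_left]
  have left i j k l m : S i j k l m = - S i k j l m := by
    simp only [S]
    rw [curvature_swap, covDeriv_neg ((F.smooth k).curvature (F.smooth j) (F.smooth l)),
      Pi.neg_apply, inner_neg_left]
  have right i j k l m : S i j k l m = - S i j k m l := by
    have hc l := (F.smooth j).curvature (F.smooth k) (F.smooth l)
    simp only [S]
    rw [inner_covDeriv_of_leviCivita_eq_zero (F.smooth i) (hc l) (F.smooth m) (F.leviCivita_eq m),
      inner_covDeriv_of_leviCivita_eq_zero (F.smooth i) (hc m) (F.smooth l) (F.leviCivita_eq l),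
      metric_curvature_swap (F.smooth j) (F.smooth k) (F.smooth l) (F.smooth m)]
    simp only [dirDeriv, mvfderiv_neg, _root_.neg_apply]
  have hscal : dirDeriv I (F.field k) (scal I) x = ∑ j, ∑ i, S k i j j i := by
    rw [F.dirDeriv_scal]
    refine Finset.sum_congr rfl fun j _ ↦ ?_
    rw [F.inner_covDeriv_ricciEnd (F.smooth k) (F.smooth j),
      F.dirDeriv_ricciFun (F.smooth j) (F.smooth j)]
  have hric i : dirDeriv I (F.field i) (ricciFun (F.field k) (F.field i)) x = ∑ j, S i j k i j :=
    F.dirDeriv_ricciFun (F.smooth k) (F.smooth i)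
  -- Summed over `i` and `j`, each of the two terms on the right is the divergence of `Ric`.
  have key i j : S k i j j i = S i j k i j + S j i k j i := by
    have h1 := cyc k i j j i
    have h2 := right i j k j i
    have h3 := left j k i j i
    linarith
  simp only [hscal, hric, key, Finset.sum_add_distrib]
  rw [Finset.sum_comm, two_mul]

end NormalFrame

end Bianchi

/-! ### Gradient almost Einstein solitons -/

section Soliton

variable {X Y V : Π x : M, TangentSpace I x} {x : M} {f g : M → ℝ}

theorem inner_grad (f : M → ℝ) (x : M) (v : TangentSpace I x) :
    inner ℝ (grad I f x) v = mvfderiv I f x v :=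
  InnerProductSpace.toDual_symm_apply

theorem metric_grad : metric I (grad I f) X = dirDeriv I X f :=
  funext fun x ↦ inner_grad f x (X x)

theorem grad_add (hf : MDiffAt f x) (hg : MDiffAt g x) :
    grad I (f + g) x = grad I f x + grad I g x := by
  refine ext_inner_right ℝ fun v ↦ ?_
  simp only [inner_add_left, inner_grad, mvfderiv_add hf hg, _root_.add_apply]

theorem grad_const_mul (c : ℝ) (hf : MDiffAt f x) :
    grad I (fun y ↦ c * f y) x = c • grad I f x := by
  refine ext_inner_right ℝ fun v ↦ ?_
  have := mvfderiv_mul (I := I) (x := x) (f := fun _ ↦ c) mdifferentiableAt_const hf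
  rw [inner_smul_left, inner_grad, inner_grad]
  change mvfderiv I ((fun _ ↦ c) * f) x v = _
  rw [this, mvfderiv_const]
  simp

theorem smoothField_grad [T2Space M] (hf : ContMDiff I 𝓘(ℝ, ℝ) ∞ f) :
    SmoothField I (grad I f) :=
  smoothField_of_metric fun W hW ↦ by
    rw [metric_grad]
    exact hW.dirDeriv hf

/-- The Hessian is symmetric. -/
theorem inner_leviCivita_grad_comm [T2Space M] (hf : ContMDiff I 𝓘(ℝ, ℝ) ∞ f)
    (u v : TangentSpace I x) :
    inner ℝ (leviCivita I M (grad I f) x u) v = inner ℝ u (leviCivita I M (grad I f) x v) := by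
  obtain ⟨X, hX, rfl⟩ := exists_smoothField_apply_eq u
  obtain ⟨Y, hY, rfl⟩ := exists_smoothField_apply_eq v
  have hG := smoothField_grad hf
  have h1 := congrFun (dirDeriv_metric hX hG hY) x
  have h2 := congrFun (dirDeriv_metric hY hG hX) x
  have h3 := congrFun (dirDeriv_mlieBracket hX hY hf) x
  have h4 : dirDeriv I (covDeriv X Y - covDeriv Y X) f x
      = dirDeriv I (covDeriv X Y) f x - dirDeriv I (covDeriv Y X) f x := by
    simp [dirDeriv]
  simp only [metric_grad, Pi.add_apply] at h1 h2
  rw [← covDeriv_sub_covDeriv hX hY, h4, Pi.sub_apply] at h3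
  rw [real_inner_comm _ (X x)]
  change metric I (covDeriv X (grad I f)) Y x = metric I (covDeriv Y (grad I f)) X x
  linarith

theorem lieMetric_eq (hV : SmoothField I V) (u v : TangentSpace I x) :
    lieMetric V x u v
      = inner ℝ (leviCivita I M V x u) v + inner ℝ u (leviCivita I M V x v) := by
  have hX : MDiffAt (T% (extend E u : Π x : M, TangentSpace I x)) x := mdifferentiableAt_extend ..
  have hY : MDiffAt (T% (extend E v : Π x : M, TangentSpace I x)) x := mdifferentiableAt_extend ..
  have tor {X Y : Π x : M, TangentSpace I x} (hX : MDiffAt (T% X) x) (hY : MDiffAt (T% Y) x) :=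
    (CovariantDerivative.torsion_eq_zero_iff _).1 leviCivita_torsion hX hY
  rw [lieMetric, leviCivita_metric (hV.mdiff x) hX hY, ← tor (hV.mdiff x) hX,
    ← tor (hV.mdiff x) hY]
  simp only [extend_apply_self, inner_sub_left, inner_sub_right]
  ring

/-- If `∇_u V = φ u - Q u`, then `Ric(e_k, V) = (1 - n) dφ(e_k) + ½ d scal(e_k)`. This is the trace
of the identity `R(X, Y)V = (Xφ) Y - (Yφ) X - (∇_X Q)Y + (∇_Y Q)X`, combined with the contracted
Bianchi identity. -/
theorem NormalFrame.ricci_apply [T2Space M] (F : NormalFrame I x) {φ : M → ℝ}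
    (hφ : ContMDiff I 𝓘(ℝ, ℝ) ∞ φ) (hV : SmoothField I V)
    (h : ∀ y u, leviCivita I M V y u = φ y • u - ricciOperator y u)
    (k : Fin (Module.finrank ℝ (TangentSpace I x))) :
    ricci x (F.field k x) (V x)
      = (1 - (Module.finrank ℝ E : ℝ)) * dirDeriv I (F.field k) φ x
        + (1 / 2) * dirDeriv I (F.field k) (scal I) x := by
  have hcov i : covDeriv (F.field i) V
      = φ • F.field i - fun y ↦ ricciEnd y (F.field i y) := funext fun y ↦ h y _
  have hcov2 i j : covDeriv (F.field i) (covDeriv (F.field j) V) x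
      = dirDeriv I (F.field i) φ x • F.field j x
        - covDeriv (F.field i) (fun y ↦ ricciEnd y (F.field j y)) x := by
    rw [hcov, covDeriv_sub ((F.smooth j).smul hφ) (smoothField_ricciEnd _ (F.smooth j)),
      covDeriv_smul hφ (F.smooth j), Pi.sub_apply, Pi.add_apply, Pi.smul_apply', covDeriv,
      F.leviCivita_eq]
    simp
  have hbr i : covDeriv (mlieBracket I (F.field i) (F.field k)) V x = 0 := by
    rw [← covDeriv_sub_covDeriv (F.smooth i) (F.smooth k), covDeriv, Pi.sub_apply, covDeriv,
      covDeriv, F.leviCivita_eq, F.leviCivita_eq]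
    simp
  have hterm i : inner ℝ (riemann x (F.field i x) (F.field k x) (V x)) (F.field i x)
      = dirDeriv I (F.field i) φ x * (if k = i then 1 else 0)
        - dirDeriv I (F.field i) (ricciFun (F.field k) (F.field i)) x
        - dirDeriv I (F.field k) φ x
        + inner ℝ (covDeriv (F.field k) (fun y ↦ ricciEnd y (F.field i y)) x) (F.field i x) := by
    rw [riemann_apply (F.smooth i) (F.smooth k) hV, curvature_eq]
    simp only [Pi.sub_apply, hcov2, hbr, inner_sub_left, inner_smul_left, RCLike.conj_to_real,
      inner_zero_left, F.inner_covDeriv_ricciEnd (F.smooth i) (F.smooth k) i]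
    simp only [F.apply_eq, (stdOrthonormalBasis ℝ (TangentSpace I x)).inner_eq_ite]
    simp only [if_true]
    ring
  have hfin : Module.finrank ℝ (TangentSpace I x) = Module.finrank ℝ E := rfl
  rw [ricci]
  simp only [← F.apply_eq, hterm, Finset.sum_add_distrib, Finset.sum_sub_distrib, mul_ite, mul_one,
    mul_zero, Finset.sum_ite_eq, Finset.mem_univ, if_true, ← F.dirDeriv_scal, Finset.sum_const,
    Finset.card_univ, Fintype.card_fin, nsmul_eq_mul, hfin]
  have := F.contracted_bianchi k
  linarith

namespace IsAlmostEinsteinSoliton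

variable [T2Space M] {lam : M → ℝ}

/-- The soliton equation of a gradient field reads `∇_u grad f = (scal / 2 + λ) u - Q u`. -/
theorem leviCivita_grad (hsol : IsAlmostEinsteinSoliton (grad I f) lam)
    (hf : ContMDiff I 𝓘(ℝ, ℝ) ∞ f) (x : M) (u : TangentSpace I x) :
    leviCivita I M (grad I f) x u = (scal I x / 2 + lam x) • u - ricciOperator x u := by
  refine ext_inner_right ℝ fun v ↦ ?_
  have h := hsol.equation x u v
  rw [lieMetric_eq hsol.smooth_field, ← inner_leviCivita_grad_comm hf u v] at h
  rw [inner_sub_left, inner_smul_left, inner_ricciOperator, RCLike.conj_to_real]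
  linarith

theorem ricci_comm (hsol : IsAlmostEinsteinSoliton (grad I f) lam)
    (hf : ContMDiff I 𝓘(ℝ, ℝ) ∞ f) (x : M) (u v : TangentSpace I x) :
    ricci x u v = ricci x v u := by
  have h1 := hsol.equation x u v
  have h2 := hsol.equation x v u
  rw [lieMetric_eq hsol.smooth_field, ← inner_leviCivita_grad_comm hf] at h1 h2
  rw [inner_leviCivita_grad_comm hf, real_inner_comm, real_inner_comm u v] at h2
  linarith

theorem ricciOperator_grad (hsol : IsAlmostEinsteinSoliton (grad I f) lam)
    (hf : ContMDiff I 𝓘(ℝ, ℝ) ∞ f) (x : M) :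
    ricciOperator x (grad I f x) = -((Module.finrank ℝ E : ℝ) - 1) • grad I lam x
      - (((Module.finrank ℝ E : ℝ) - 2) / 2) • grad I (scal I) x := by
  obtain ⟨F⟩ := nonempty_normalFrame (I := I) x
  refine InnerProductSpace.ext_inner_right_basis
    (stdOrthonormalBasis ℝ (TangentSpace I x)).toBasis fun k ↦ ?_
  have hs : ContMDiff I 𝓘(ℝ, ℝ) ∞ fun y : M ↦ (1 / 2 : ℝ) * scal I y :=
    contMDiff_const.mul contMDiff_scal
  have hφ : ContMDiff I 𝓘(ℝ, ℝ) ∞ ((fun y ↦ (1 / 2 : ℝ) * scal I y) + lam) :=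
    hs.add hsol.smooth_function
  have h := F.ricci_apply hφ hsol.smooth_field
    (fun y u ↦ (hsol.leviCivita_grad hf y u).trans (by
      rw [Pi.add_apply, div_eq_inv_mul, one_div])) k
  rw [← metric_grad, ← metric_grad] at h
  simp only [metric] at h
  rw [grad_add ((hs x).mdifferentiableAt (by simp))
    ((hsol.smooth_function x).mdifferentiableAt (by simp)),
    grad_const_mul _ ((contMDiff_scal x).mdifferentiableAt (by simp)), inner_add_left,
    inner_smul_left, RCLike.conj_to_real] at h
  rw [OrthonormalBasis.coe_toBasis, ← F.apply_eq, inner_ricciOperator, hsol.ricci_comm hf, h,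
    inner_sub_left, inner_smul_left, inner_smul_left, RCLike.conj_to_real, RCLike.conj_to_real]
  ring

/-- The trace of the soliton equation. -/
theorem laplacian_eq (hsol : IsAlmostEinsteinSoliton (grad I f) lam)
    (hf : ContMDiff I 𝓘(ℝ, ℝ) ∞ f) (x : M) :
    laplacian I f x = (Module.finrank ℝ E : ℝ) * lam x
      + (((Module.finrank ℝ E : ℝ) - 2) / 2) * scal I x := by
  have h : (leviCivita I M (grad I f) x : TangentSpace I x →ₗ[ℝ] TangentSpace I x)
      = (scal I x / 2 + lam x) • LinearMap.id - ricciEnd x :=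
    LinearMap.ext fun u ↦ hsol.leviCivita_grad hf x u
  have hfin : Module.finrank ℝ (TangentSpace I x) = Module.finrank ℝ E := rfl
  rw [laplacian, divergence, h, map_sub, map_smul, LinearMap.trace_id, ← scal_eq_trace, hfin,
    smul_eq_mul]
  ring

theorem grad_laplacian (hsol : IsAlmostEinsteinSoliton (grad I f) lam)
    (hf : ContMDiff I 𝓘(ℝ, ℝ) ∞ f) (x : M) :
    grad I (laplacian I f) x = (Module.finrank ℝ E : ℝ) • grad I lam x
      + (((Module.finrank ℝ E : ℝ) - 2) / 2) • grad I (scal I) x := by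
  have hl := (hsol.smooth_function x).mdifferentiableAt (by simp)
  have hs : MDiffAt (scal I : M → ℝ) x := (contMDiff_scal x).mdifferentiableAt (by simp)
  rw [show laplacian I f = (fun y ↦ (Module.finrank ℝ E : ℝ) * lam y)
      + fun y ↦ (((Module.finrank ℝ E : ℝ) - 2) / 2) * scal I y from
    funext fun y ↦ hsol.laplacian_eq hf y,
    grad_add (f := fun y ↦ (Module.finrank ℝ E : ℝ) * lam y)
      (g := fun y ↦ (((Module.finrank ℝ E : ℝ) - 2) / 2) * scal I y)
      (mdifferentiableAt_const.mul hl) (mdifferentiableAt_const.mul hs),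
    grad_const_mul _ hl, grad_const_mul _ hs]

end IsAlmostEinsteinSoliton

end Soliton

end RiemGeom

end

theorem mainTheorem2 (n : ℕ) (hn : 3 ≤ n)
    (M : Type*) [TopologicalSpace M] [T2Space M] [SecondCountableTopology M]
    [ChartedSpace (EuclideanSpace ℝ (Fin n)) M] [IsManifold (𝓡 n) ∞ M]
    [RiemannianBundle (fun x : M ↦ TangentSpace (𝓡 n) x)]
    [IsContMDiffRiemannianBundle (𝓡 n) ∞ (EuclideanSpace ℝ (Fin n))
      (fun x : M ↦ TangentSpace (𝓡 n) x)]
    (f lam : M → ℝ) (hf : ContMDiff (𝓡 n) 𝓘(ℝ, ℝ) ∞ f)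
    (hsol : RiemGeom.IsAlmostEinsteinSoliton (RiemGeom.grad (𝓡 n) f) lam) :
    (∀ x : M, RiemGeom.ricciOperator x (RiemGeom.grad (𝓡 n) f x) =
      -((n : ℝ) - 1) • RiemGeom.grad (𝓡 n) lam x
        - (((n : ℝ) - 2) / 2) • RiemGeom.grad (𝓡 n) (RiemGeom.scal (𝓡 n)) x) ∧
    ((∀ x : M, RiemGeom.ricciOperator x (RiemGeom.grad (𝓡 n) f x) = 0) →
      ∀ x : M,
        RiemGeom.grad (𝓡 n) lam x
          = RiemGeom.grad (𝓡 n) (RiemGeom.laplacian (𝓡 n) f) x ∧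
        RiemGeom.grad (𝓡 n) (RiemGeom.laplacian (𝓡 n) f) x
          = -(((n : ℝ) - 2) / (2 * ((n : ℝ) - 1))) •
              RiemGeom.grad (𝓡 n) (RiemGeom.scal (𝓡 n)) x) := by
  have hfin : (Module.finrank ℝ (EuclideanSpace ℝ (Fin n)) : ℝ) = n := by simp
  have hQ := hsol.ricciOperator_grad hf
  have hL := hsol.grad_laplacian hf
  rw [hfin] at hQ hL
  refine ⟨hQ, fun h0 x ↦ ?_⟩
  have hn1 : (n : ℝ) - 1 ≠ 0 := by
    have : (3 : ℝ) ≤ n := by exact_mod_cast hn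
    linarith
  -- `Q (grad f) = 0` determines `grad λ` by the first part, as `n ≠ 1`.
  have hlam : RiemGeom.grad (𝓡 n) lam x
      = -(((n : ℝ) - 2) / (2 * ((n : ℝ) - 1))) •
        RiemGeom.grad (𝓡 n) (RiemGeom.scal (𝓡 n)) x := by
    have h := hQ x
    rw [h0 x, eq_comm, sub_eq_zero, neg_smul, neg_eq_iff_eq_neg, eq_comm] at h
    rw [← inv_smul_smul₀ hn1 (RiemGeom.grad (𝓡 n) lam x), ← h, ← neg_smul, smul_smul]
    congr 1
    field_simp
  rw [hL x, hlam]
  refine ⟨?_, ?_⟩ <;> rw [smul_smul, ← add_smul] <;> congr 1 <;> field_simp <;> ring
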